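/- Let $n\ge 2$ and let $f\in\mathbb{C}\{\underline x\}=\mathbb{C}\{x_1,\dots,x_n\}$ be a convergent power series with $f(0)=0$ and an isolated critical point at the origin, i.e. $\langle\underline\partial(f)\rangle\subseteq\langle\underline x\rangle$ and $\langle\underline x\rangle^m\subseteq\langle\underline\partial(f)\rangle$ for some $m\ge1$, where $\langle\underline\partial(f)\rangle=\langle\partial_1(f),\dots,\partial_n(f)\rangle$ and $\langle\underline x\rangle=\langle x_1,\dots,x_n\rangle$. Let $\mu=\dim_{\mathbb{C}}\mathbb{C}\{\underline x\}/\langle\underline\partial(f)\rangle$ be the Milnor number, let $\Omega^p$ be the module of germs at $0\in\mathbb{C}^n$ of holomorphic $p$-forms, and let $H''=\Omega^n/\mathrm{d}f\wedge\mathrm{d}\Omega^{n-2}$ be the Brieskorn lattice, with the (well-defined) $\mathbb{C}$-linear operator $s$ given by $s[\mathrm{d}\eta]=[\mathrm{d}f\wedge\eta]$ for $\eta\in\Omega^{n-1}$. The $\langle s\rangle$-adic topology on $H''$ is the one given by the subspaces $s^kH''$; the $\langle\underline x\rangle$-adic topology on $H''$ is the quotient of the $\langle\underline x\rangle$-adic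 topology on $\Omega^n$. Denote by $X_k\subseteq H''$ the image of $\langle\underline x\rangle^k\Omega^n$. The formal Brieskorn lattice is the $\langle\underline x\rangle$-adic completion $\widehat H''=\varprojlim_k H''/X_k$, and the $\langle s\rangle$-adic completion of $H''$ is $\varprojlim_k H''/s^kH''$. Since $sX_k\subseteq X_{k+1}$, and hence $s^kH''\subseteq X_k$, both are $\mathbb{C}[[s]]$-modules: a power series $\sum_i a_is^i$ acts on the $k$-th quotient as $\sum_{i<k}a_is^i$. Then: 1. For every $m\ge1$ with $\langle\underline x\rangle^m\subseteq\langle\underline\partial(f)\rangle$ and every $k\ge0$, $X_{2km}\subseteq s^kH''\subseteq X_k$. 2. The $\langle s\rangle$-adic and the $\langle\underline x\rangle$-adic topology on $H''$ coincide. 3. The $\langle s\rangle$-adic completion of $H''$ is naturally isomorphic to $\widehat H''$: there is a $\mathbb{C}[[s]]$-linear isomorphism between them that is compatible with the canonical maps from $H''$. 4. $\mu<\infty$ and $\widehat H''$ is a free $\mathbb{C}[[s]]$-module of rank $\mu$. -/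

import Mathlib

noncomputable section

namespace Brieskorn

/-! ### Convergent power series -/

/-- The formal power series `g` converges absolutely at some point `(r, …, r)` with `r > 0`. -/
def IsConvergent {n : ℕ} (g : MvPowerSeries (Fin n) ℂ) : Prop :=
  ∃ r : ℝ, 0 < r ∧ Summable fun m : Fin n →₀ ℕ => ‖MvPowerSeries.coeff m g‖ * r ^ m.degree

lemma summable_antidiagonal_mul {n : ℕ} {F G : (Fin n →₀ ℕ) → ℝ} (hF : Summable F)
    (hG : Summable G) (hF0 : ∀ m, 0 ≤ F m) (hG0 : ∀ m, 0 ≤ G m) :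
    Summable fun m => ∑ p ∈ Finset.HasAntidiagonal.antidiagonal m, F p.1 * G p.2 :=
  summable_sum_mul_antidiagonal_of_summable_mul (hF.mul_of_nonneg hG hF0 hG0)

lemma IsConvergent.mul {n : ℕ} {g h : MvPowerSeries (Fin n) ℂ}
    (Hg : IsConvergent g) (Hh : IsConvergent h) : IsConvergent (g * h) := by
  obtain ⟨r, hr, hg⟩ := Hg
  obtain ⟨r', hr', hh⟩ := Hh
  have hm : 0 < min r r' := lt_min hr hr'
  refine ⟨min r r', hm, ?_⟩
  have h1 : min r r' ≤ r := min_le_left _ _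
  have h2 : min r r' ≤ r' := min_le_right _ _
  generalize min r r' = q at hm h1 h2 ⊢
  have hg' : Summable fun m : Fin n →₀ ℕ => ‖MvPowerSeries.coeff m g‖ * q ^ m.degree :=
    hg.of_nonneg_of_le (fun m => by positivity) (fun m => by gcongr)
  have hh' : Summable fun m : Fin n →₀ ℕ => ‖MvPowerSeries.coeff m h‖ * q ^ m.degree :=
    hh.of_nonneg_of_le (fun m => by positivity) (fun m => by gcongr)
  have key := summable_antidiagonal_mul hg' hh'
    (fun m => by positivity) (fun m => by positivity)
  refine key.of_nonneg_of_le (fun m => by positivity) (fun m => ?_)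
  rw [MvPowerSeries.coeff_mul]
  refine (mul_le_mul_of_nonneg_right (norm_sum_le _ _) (by positivity)).trans ?_
  rw [Finset.sum_mul]
  refine Finset.sum_le_sum fun p hp => le_of_eq ?_
  rw [← Finset.HasAntidiagonal.mem_antidiagonal.mp hp, norm_mul, map_add, pow_add]
  ring

lemma IsConvergent.add {n : ℕ} {g h : MvPowerSeries (Fin n) ℂ}
    (Hg : IsConvergent g) (Hh : IsConvergent h) : IsConvergent (g + h) := by
  obtain ⟨r, hr, hg⟩ := Hg
  obtain ⟨r', hr', hh⟩ := Hh
  have hm : 0 < min r r' := lt_min hr hr'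
  refine ⟨min r r', hm, ?_⟩
  have h1 : min r r' ≤ r := min_le_left _ _
  have h2 : min r r' ≤ r' := min_le_right _ _
  generalize min r r' = q at hm h1 h2 ⊢
  refine (hg.add hh).of_nonneg_of_le (fun m => by positivity) (fun m => ?_)
  rw [map_add]
  calc ‖MvPowerSeries.coeff m g + MvPowerSeries.coeff m h‖ * q ^ m.degree
      ≤ (‖MvPowerSeries.coeff m g‖ + ‖MvPowerSeries.coeff m h‖) * q ^ m.degree := by
        gcongr; exact norm_add_le _ _
    _ = ‖MvPowerSeries.coeff m g‖ * q ^ m.degree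
        + ‖MvPowerSeries.coeff m h‖ * q ^ m.degree := by ring
    _ ≤ _ := by gcongr

lemma isConvergent_C {n : ℕ} (c : ℂ) :
    IsConvergent (MvPowerSeries.C c : MvPowerSeries (Fin n) ℂ) := by
  refine ⟨1, one_pos, summable_of_ne_finset_zero (s := {0}) fun m hm => ?_⟩
  rw [MvPowerSeries.coeff_C, if_neg (by simpa using hm)]
  simp

lemma isConvergent_X {n : ℕ} (i : Fin n) :
    IsConvergent (MvPowerSeries.X i : MvPowerSeries (Fin n) ℂ) := by
  refine ⟨1, one_pos, summable_of_ne_finset_zero (s := {Finsupp.single i 1}) fun m hm => ?_⟩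
  rw [MvPowerSeries.coeff_X, if_neg (by simpa using hm)]
  simp

lemma IsConvergent.pderiv {n : ℕ} (i : Fin n) {g : MvPowerSeries (Fin n) ℂ}
    (hg : IsConvergent g) : IsConvergent (MvPowerSeries.pderiv ℂ i g) := by
  obtain ⟨r, hr, hs⟩ := hg
  refine ⟨r / 2, by positivity, ?_⟩
  have hinj : Function.Injective fun m : Fin n →₀ ℕ => m + Finsupp.single i 1 :=
    add_left_injective _
  refine ((hs.comp_injective hinj).mul_left r⁻¹).of_nonneg_of_le
    (fun m => by positivity) (fun m => ?_)
  rw [MvPowerSeries.coeff_pderiv]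
  simp only [Function.comp_apply, map_add, Finsupp.degree_single, pow_succ, norm_mul, div_pow]
  have h1 : m i ≤ m.degree := Finsupp.le_degree i m
  have h2 : m.degree < 2 ^ m.degree := Nat.lt_two_pow_self
  have h3 : ‖((m i : ℂ) + 1)‖ ≤ 2 ^ m.degree := by
    have : ((m i : ℂ) + 1) = ((m i + 1 : ℕ) : ℂ) := by push_cast; rfl
    rw [this, Complex.norm_natCast]
    exact_mod_cast (by omega : m i + 1 ≤ 2 ^ m.degree)
  set c := ‖MvPowerSeries.coeff (m + Finsupp.single i 1) g‖
  calc c * ‖((m i : ℂ) + 1)‖ * (r ^ m.degree / 2 ^ m.degree)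
      ≤ c * 2 ^ m.degree * (r ^ m.degree / 2 ^ m.degree) := by gcongr
    _ = r⁻¹ * (c * (r ^ m.degree * r)) := by field_simp

/-- The ring `ℂ{x₁, …, xₙ}` of convergent power series. -/
def convergent (n : ℕ) : Subalgebra ℂ (MvPowerSeries (Fin n) ℂ) where
  carrier := {g | IsConvergent g}
  mul_mem' := IsConvergent.mul
  add_mem' := IsConvergent.add
  algebraMap_mem' c := isConvergent_C c

/-- `ℂ{x₁, …, xₙ}` as a type. -/
def ConvPS (n : ℕ) : Type := convergent n

instance (n : ℕ) : CommRing (ConvPS n) := inferInstanceAs (CommRing (convergent n))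

instance (n : ℕ) : Algebra ℂ (ConvPS n) := inferInstanceAs (Algebra ℂ (convergent n))

variable {n : ℕ}

lemma ConvPS.ext {g h : ConvPS n}
    (H : ∀ m, MvPowerSeries.coeff m g.1 = MvPowerSeries.coeff m h.1) : g = h :=
  Subtype.ext (MvPowerSeries.ext H)

/-- The coordinate `xᵢ` in `ℂ{x₁, …, xₙ}`. -/
def coord (i : Fin n) : ConvPS n := ⟨MvPowerSeries.X i, isConvergent_X i⟩

/-- The partial derivative `∂ᵢ` on `ℂ{x₁, …, xₙ}`. -/
def partialD (i : Fin n) : ConvPS n →ₗ[ℂ] ConvPS n where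
  toFun g := ⟨MvPowerSeries.pderiv ℂ i g.1, IsConvergent.pderiv i g.2⟩
  map_add' g h := Subtype.ext (map_add (MvPowerSeries.pderiv ℂ i) g.1 h.1)
  map_smul' c g := Subtype.ext ((MvPowerSeries.pderiv ℂ i).map_smul c g.1)

/-- The ideal `⟨x⟩ = ⟨x₁, …, xₙ⟩` of `ℂ{x₁, …, xₙ}`. -/
def maxIdeal (n : ℕ) : Ideal (ConvPS n) := Ideal.span (Set.range coord)

/-- The ideal `⟨∂(f)⟩ = ⟨∂₁(f), …, ∂ₙ(f)⟩`. -/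
def jacobianIdeal (f : ConvPS n) : Ideal (ConvPS n) :=
  Ideal.span (Set.range fun i => partialD i f)

/-- The origin is an isolated critical point of `f`. -/
def IsIsolatedCriticalPoint (f : ConvPS n) : Prop :=
  jacobianIdeal f ≤ maxIdeal n ∧ ∃ m : ℕ, 1 ≤ m ∧ maxIdeal n ^ m ≤ jacobianIdeal f

/-- The Milnor algebra `ℂ{x} / ⟨∂(f)⟩`. -/
abbrev MilnorAlgebra (f : ConvPS n) : Type := ConvPS n ⧸ jacobianIdeal f

/-- The Milnor number `μ = dim_ℂ ℂ{x} / ⟨∂(f)⟩`. -/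
def milnorNumber (f : ConvPS n) : ℕ := Module.finrank ℂ (MilnorAlgebra f)

/-! ### Differential forms -/

/-- Germs of holomorphic differential forms (of mixed degree) at `0 ∈ ℂⁿ`: the function `ω` stands
for `∑_J ω(J) dx_J`, where `dx_J = dx_{j₁} ∧ ⋯ ∧ dx_{jₚ}` for `J = {j₁ < ⋯ < jₚ}`. -/
abbrev Form (n : ℕ) : Type := Finset (Fin n) → ConvPS n

/-- The forms of pure degree `p`. -/
def formsOfDegree (n p : ℕ) : Submodule (ConvPS n) (Form n) where
  carrier := {ω | ∀ J, J.card ≠ p → ω J = 0}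
  add_mem' := fun ha hb J hJ => by simp [ha J hJ, hb J hJ]
  zero_mem' := fun _ _ => rfl
  smul_mem' := fun c ω h J hJ => by simp [h J hJ]

/-- The sign `(-1)^#{j ∈ J | j < i}`; for `i ∈ J`, it is the sign `ε` in
`dx_i ∧ dx_{J ∖ i} = ε dx_J`. -/
def wedgeSign (i : Fin n) (J : Finset (Fin n)) : ℤ := (-1) ^ (J.filter (· < i)).card

/-- The exterior derivative, `d(g dx_I) = ∑ᵢ ∂ᵢ(g) dxᵢ ∧ dx_I`. -/
def extD : Form n →ₗ[ℂ] Form n where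
  toFun ω J := ∑ i ∈ J, wedgeSign i J • partialD i (ω (J.erase i))
  map_add' ω η := by
    funext J
    simp only [Pi.add_apply, map_add, smul_add, Finset.sum_add_distrib]
  map_smul' c ω := by
    funext J
    simp only [Pi.smul_apply, map_smul, Finset.smul_sum, RingHom.id_apply]
    exact Finset.sum_congr rfl fun i _ => smul_comm _ _ _

/-- The map `ω ↦ df ∧ ω`, where `df = ∑ᵢ ∂ᵢ(f) dxᵢ`. -/
def dfWedge (f : ConvPS n) : Form n →ₗ[ConvPS n] Form n where
  toFun ω J := ∑ i ∈ J, wedgeSign i J • (partialD i f * ω (J.erase i))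
  map_add' ω η := by
    funext J
    simp only [Pi.add_apply, mul_add, smul_add, Finset.sum_add_distrib]
  map_smul' c ω := by
    funext J
    simp only [Pi.smul_apply, Finset.mul_sum, RingHom.id_apply, smul_eq_mul]
    refine Finset.sum_congr rfl fun i _ => ?_
    rw [mul_smul_comm, mul_left_comm]

lemma extD_mem {p : ℕ} {ω : Form n} (h : ω ∈ formsOfDegree n p) :
    extD ω ∈ formsOfDegree n (p + 1) := by
  intro J hJ
  refine Finset.sum_eq_zero fun i hi => ?_
  rw [h (J.erase i) (by rw [Finset.card_erase_of_mem hi]; have := Finset.card_pos.mpr ⟨i, hi⟩; omega)]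
  simp

lemma dfWedge_mem (f : ConvPS n) {p : ℕ} {ω : Form n} (h : ω ∈ formsOfDegree n p) :
    dfWedge f ω ∈ formsOfDegree n (p + 1) := by
  intro J hJ
  refine Finset.sum_eq_zero fun i hi => ?_
  rw [h (J.erase i) (by rw [Finset.card_erase_of_mem hi]; have := Finset.card_pos.mpr ⟨i, hi⟩; omega)]
  simp

/-! ### The Poincaré lemma

Contraction with the Euler vector field, divided by the weight, is a homotopy for `d`. -/

lemma isConvergent_divWeight (w : ℕ) {g : MvPowerSeries (Fin n) ℂ} (hg : IsConvergent g) :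
    IsConvergent (fun m => (((m.degree + w : ℕ) : ℂ))⁻¹ * MvPowerSeries.coeff m g :
      MvPowerSeries (Fin n) ℂ) := by
  obtain ⟨r, hr, hs⟩ := hg
  refine ⟨r, hr, hs.of_nonneg_of_le (fun m => by positivity) (fun m => ?_)⟩
  change ‖(((m.degree + w : ℕ) : ℂ))⁻¹ * MvPowerSeries.coeff m g‖ * _ ≤ _
  rw [norm_mul, norm_inv, Complex.norm_natCast]
  gcongr
  exact mul_le_of_le_one_left (norm_nonneg _) (Nat.cast_inv_le_one _)

/-- Divide the coefficient of `x^m` by `|m| + w`. -/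
def divWeight (w : ℕ) : ConvPS n →ₗ[ℂ] ConvPS n where
  toFun g := ⟨_, isConvergent_divWeight w g.2⟩
  map_add' g h := ConvPS.ext fun m => by
    change _ * (MvPowerSeries.coeff m (g.1 + h.1)) = _ * _ + _ * _
    rw [map_add, mul_add]
  map_smul' c g := ConvPS.ext fun m => by
    change _ * (MvPowerSeries.coeff m (c • g.1)) = c * (_ * _)
    rw [MvPowerSeries.coeff_smul]
    ring

lemma coeff_divWeight (w : ℕ) (g : ConvPS n) (m : Fin n →₀ ℕ) :
    MvPowerSeries.coeff m (divWeight w g).1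
      = (((m.degree + w : ℕ) : ℂ))⁻¹ * MvPowerSeries.coeff m g.1 := rfl

lemma coeff_partialD (i : Fin n) (g : ConvPS n) (m : Fin n →₀ ℕ) :
    MvPowerSeries.coeff m (partialD i g).1
      = MvPowerSeries.coeff (m + Finsupp.single i 1) g.1 * (m i + 1) :=
  MvPowerSeries.coeff_pderiv ..

lemma partialD_mul (i : Fin n) (g h : ConvPS n) :
    partialD i (g * h) = g * partialD i h + partialD i g * h := by
  apply Subtype.ext
  change MvPowerSeries.pderiv ℂ i (g.1 * h.1) = g.1 * MvPowerSeries.pderiv ℂ i h.1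
    + MvPowerSeries.pderiv ℂ i g.1 * h.1
  rw [Derivation.leibniz, smul_eq_mul, smul_eq_mul]
  ring

lemma partialD_coord_mul (i j : Fin n) (g : ConvPS n) :
    partialD i (coord j * g) = coord j * partialD i g + if i = j then g else 0 := by
  rw [partialD_mul]
  congr 1
  split_ifs with h
  · subst h
    have : partialD i (coord i) = 1 := Subtype.ext MvPowerSeries.pderiv_X_self
    rw [this, one_mul]
  · have : partialD i (coord j) = 0 :=
      Subtype.ext (MvPowerSeries.pderiv_X_of_ne (Ne.symm h))
    rw [this, zero_mul]

lemma partialD_comm (i j : Fin n) (g : ConvPS n) :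
    partialD i (partialD j g) = partialD j (partialD i g) := by
  refine ConvPS.ext fun m => ?_
  simp only [coeff_partialD, Finsupp.add_apply]
  by_cases h : i = j
  · subst h; rfl
  · rw [Finsupp.single_eq_of_ne (by tauto), Finsupp.single_eq_of_ne (by tauto),
      add_right_comm m]
    push_cast
    ring

lemma coeff_coord_mul (i : Fin n) (g : ConvPS n) (m : Fin n →₀ ℕ) :
    MvPowerSeries.coeff m (coord i * g).1 =
      if m i = 0 then 0 else MvPowerSeries.coeff (m - Finsupp.single i 1) g.1 := by
  change MvPowerSeries.coeff m (MvPowerSeries.X i * g.1) = _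
  rw [MvPowerSeries.X, MvPowerSeries.coeff_monomial_mul]
  simp only [one_mul, Finsupp.single_le_iff]
  split_ifs <;> first | rfl | omega

lemma coeff_euler (g : ConvPS n) (m : Fin n →₀ ℕ) :
    MvPowerSeries.coeff m (∑ i, coord i * partialD i g).1
      = (m.degree : ℂ) * MvPowerSeries.coeff m g.1 := by
  have h1 : ∀ i, MvPowerSeries.coeff m (coord i * partialD i g).1
      = (m i : ℂ) * MvPowerSeries.coeff m g.1 := by
    intro i
    rw [coeff_coord_mul]
    split_ifs with h
    · simp [h]
    · rw [coeff_partialD, tsub_add_cancel_of_le (by simpa using Nat.one_le_iff_ne_zero.mpr h),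
        mul_comm]
      congr 1
      simp only [Finsupp.tsub_apply, Finsupp.single_eq_same]
      rw [Nat.cast_sub (Nat.one_le_iff_ne_zero.mpr h)]
      simp
  have h2 : (∑ i, coord i * partialD i g).1 = ∑ i, (coord i * partialD i g).1 :=
    map_sum (convergent n).val _ _
  rw [h2, map_sum, Finset.sum_congr rfl fun i _ => h1 i, ← Finset.sum_mul,
    Finsupp.degree_eq_sum]
  push_cast
  rfl

lemma wedgeSign_self_mul (i : Fin n) (J : Finset (Fin n)) :
    wedgeSign i J * wedgeSign i J = 1 := by
  rw [wedgeSign, ← mul_pow]; simp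

lemma wedgeSign_insert {i j : Fin n} {J : Finset (Fin n)} (hj : j ∉ J) :
    wedgeSign i (insert j J) = if j < i then - wedgeSign i J else wedgeSign i J := by
  rw [wedgeSign, Finset.filter_insert]
  split_ifs
  · rw [Finset.card_insert_of_notMem (by simp [hj]), pow_succ, wedgeSign]; ring
  · rfl

lemma wedgeSign_erase {i j : Fin n} {J : Finset (Fin n)} (hj : j ∈ J) :
    wedgeSign i (J.erase j) = if j < i then - wedgeSign i J else wedgeSign i J := by
  conv_rhs => rw [← Finset.insert_erase hj, wedgeSign_insert (Finset.notMem_erase j J)]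
  split_ifs <;> simp

/-- Contraction with the Euler vector field `∑ xᵢ ∂ᵢ`. -/
def contract : Form n →ₗ[ConvPS n] Form n where
  toFun ω J := ∑ i ∈ Jᶜ, wedgeSign i J • (coord i * ω (insert i J))
  map_add' ω η := by
    funext J
    simp only [Pi.add_apply, mul_add, smul_add, Finset.sum_add_distrib]
  map_smul' c ω := by
    funext J
    simp only [Pi.smul_apply, Finset.mul_sum, RingHom.id_apply, smul_eq_mul]
    refine Finset.sum_congr rfl fun i _ => ?_
    rw [mul_smul_comm, mul_left_comm]

lemma contract_apply (ω : Form n) (J : Finset (Fin n)) :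
    contract ω J = ∑ i ∈ Jᶜ, wedgeSign i J • (coord i * ω (insert i J)) := rfl

lemma extD_apply (ω : Form n) (J : Finset (Fin n)) :
    extD ω J = ∑ i ∈ J, wedgeSign i J • partialD i (ω (J.erase i)) := rfl

lemma dfWedge_apply (f : ConvPS n) (ω : Form n) (J : Finset (Fin n)) :
    dfWedge f ω J = ∑ i ∈ J, wedgeSign i J • (partialD i f * ω (J.erase i)) := rfl

lemma cartan (ω : Form n) (J : Finset (Fin n)) :
    extD (contract ω) J + contract (extD ω) J
      = (J.card : ℂ) • ω J + ∑ i, coord i * partialD i (ω J) := by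
  have h1 : extD (contract ω) J = ∑ i ∈ J, ((coord i * partialD i (ω J) + ω J)
      + ∑ j ∈ Jᶜ, (wedgeSign i J * wedgeSign j (J.erase i)) •
        (coord j * partialD i (ω (insert j (J.erase i))))) := by
    rw [extD_apply]
    refine Finset.sum_congr rfl fun i hi => ?_
    rw [contract_apply, Finset.compl_erase, Finset.sum_insert (by simpa using hi),
      Finset.insert_erase hi, map_add, smul_add, map_zsmul, smul_smul, wedgeSign_erase hi,
      if_neg (lt_irrefl i), wedgeSign_self_mul, one_smul, partialD_coord_mul, if_pos rfl,
      map_sum, Finset.smul_sum]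
    congr 1
    refine Finset.sum_congr rfl fun j hj => ?_
    rw [map_zsmul, smul_smul, partialD_coord_mul, if_neg, add_zero]
    rintro rfl
    exact (Finset.mem_compl.mp hj) hi
  have h2 : contract (extD ω) J = ∑ j ∈ Jᶜ, (coord j * partialD j (ω J)
      + ∑ i ∈ J, (wedgeSign j J * wedgeSign i (insert j J)) •
        (coord j * partialD i (ω (insert j (J.erase i))))) := by
    rw [contract_apply]
    refine Finset.sum_congr rfl fun j hj => ?_
    have hj' := Finset.mem_compl.mp hj
    rw [extD_apply, Finset.sum_insert hj', Finset.erase_insert hj', mul_add, smul_add,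
      wedgeSign_insert hj', if_neg (lt_irrefl j), mul_smul_comm, smul_smul, wedgeSign_self_mul,
      one_smul, Finset.mul_sum, Finset.smul_sum]
    congr 1
    refine Finset.sum_congr rfl fun i hi => ?_
    rw [mul_smul_comm, smul_smul, Finset.erase_insert_of_ne]
    rintro rfl
    exact hj' hi
  have h3 : ∑ i ∈ J, ∑ j ∈ Jᶜ, (wedgeSign i J * wedgeSign j (J.erase i)) •
        (coord j * partialD i (ω (insert j (J.erase i))))
      + ∑ j ∈ Jᶜ, ∑ i ∈ J, (wedgeSign j J * wedgeSign i (insert j J)) •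
        (coord j * partialD i (ω (insert j (J.erase i)))) = 0 := by
    rw [Finset.sum_comm (s := Jᶜ), ← Finset.sum_add_distrib]
    refine Finset.sum_eq_zero fun i hi => ?_
    rw [← Finset.sum_add_distrib]
    refine Finset.sum_eq_zero fun j hj => ?_
    have hj' := Finset.mem_compl.mp hj
    rw [← add_smul, wedgeSign_erase hi, wedgeSign_insert hj']
    have hij : i ≠ j := by rintro rfl; exact hj' hi
    rcases lt_or_gt_of_ne hij with h | h
    · rw [if_pos h, if_neg h.asymm, show wedgeSign i J * -wedgeSign j J
        + wedgeSign j J * wedgeSign i J = 0 by ring, zero_smul]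
    · rw [if_neg h.asymm, if_pos h, show wedgeSign i J * wedgeSign j J
        + wedgeSign j J * -wedgeSign i J = 0 by ring, zero_smul]
  rw [h1, h2, Finset.sum_add_distrib, Finset.sum_add_distrib, Finset.sum_add_distrib,
    ← Finset.sum_add_sum_compl J (fun i => coord i * partialD i (ω J)), Finset.sum_const,
    Nat.cast_smul_eq_nsmul]
  linear_combination (exp := 1) h3

/-- Divide the terms of weight `w` by `w`, where `x^m dx_J` has weight `|m| + |J|`. -/
def divForm : Form n →ₗ[ℂ] Form n where
  toFun ω J := divWeight J.card (ω J)
  map_add' ω η := by funext J; exact map_add _ _ _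
  map_smul' c ω := by funext J; exact map_smul (divWeight J.card) c (ω J)

lemma divForm_apply (ω : Form n) (J : Finset (Fin n)) :
    divForm ω J = divWeight J.card (ω J) := rfl

lemma extD_divForm (ω : Form n) : extD (divForm ω) = divForm (extD ω) := by
  funext J
  rw [divForm_apply, extD_apply, extD_apply, map_sum]
  refine Finset.sum_congr rfl fun i hi => ?_
  rw [map_zsmul]
  congr 1
  refine ConvPS.ext fun m => ?_
  have : (m + Finsupp.single i 1).degree + (J.erase i).card = m.degree + J.card := by
    rw [map_add, Finsupp.degree_single, Finset.card_erase_of_mem hi]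
    have := Finset.card_pos.mpr ⟨i, hi⟩
    omega
  rw [coeff_partialD, divForm_apply, coeff_divWeight, coeff_divWeight, coeff_partialD, this,
    mul_assoc]

lemma homotopy {p : ℕ} (hp : 1 ≤ p) {ω : Form n} (hω : ω ∈ formsOfDegree n p) :
    extD (contract (divForm ω)) + contract (divForm (extD ω)) = ω := by
  rw [← extD_divForm]
  funext J
  rw [Pi.add_apply, cartan, divForm_apply]
  by_cases hJ : J.card = p
  · refine ConvPS.ext fun m => ?_
    change MvPowerSeries.coeff m (_ • (divWeight J.card (ω J)).1 + Subtype.val _) = _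
    rw [map_add, coeff_euler, MvPowerSeries.coeff_smul, coeff_divWeight, ← add_mul, ← mul_assoc]
    have : ((m.degree + J.card : ℕ) : ℂ) ≠ 0 := Nat.cast_ne_zero.mpr (by omega)
    rw [← Nat.cast_add, add_comm J.card, mul_inv_cancel₀ this, one_mul]
  · rw [hω J hJ]
    simp

lemma divForm_mem {p : ℕ} {ω : Form n} (h : ω ∈ formsOfDegree n p) :
    divForm ω ∈ formsOfDegree n p := by
  intro J hJ
  rw [divForm_apply, h J hJ, map_zero]

lemma contract_mem {p : ℕ} {ω : Form n} (h : ω ∈ formsOfDegree n (p + 1)) :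
    contract ω ∈ formsOfDegree n p := by
  intro J hJ
  rw [contract_apply]
  refine Finset.sum_eq_zero fun i hi => ?_
  rw [h (insert i J) (by
    rw [Finset.card_insert_of_notMem (Finset.mem_compl.mp hi)]; omega)]
  simp

/-- The Poincaré lemma. -/
lemma exists_extD_eq {p : ℕ} {ω : Form n} (hω : ω ∈ formsOfDegree n (p + 1))
    (h : extD ω = 0) : ∃ ζ ∈ formsOfDegree n p, extD ζ = ω := by
  refine ⟨_, contract_mem (divForm_mem hω), ?_⟩
  have := homotopy (Nat.le_add_left 1 p) hω
  rwa [h, map_zero, map_zero, add_zero] at this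

lemma extD_top {ω : Form n} (hω : ω ∈ formsOfDegree n n) : extD ω = 0 := by
  funext J
  refine extD_mem hω J ?_
  have := J.card_le_univ
  simp at this
  omega

lemma sum_swap (J : Finset (Fin n)) (G : Fin n → Fin n → ConvPS n) :
    ∑ i ∈ J, ∑ j ∈ J.erase i, (wedgeSign i J * wedgeSign j (J.erase i)) • G i j
      = -∑ i ∈ J, ∑ j ∈ J.erase i, (wedgeSign i J * wedgeSign j (J.erase i)) • G j i := by
  rw [Finset.sum_comm' (t' := J) (s' := fun j => J.erase j)
    (by simp only [Finset.mem_erase]; tauto), ← Finset.sum_neg_distrib]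
  refine Finset.sum_congr rfl fun j hj => ?_
  rw [← Finset.sum_neg_distrib]
  refine Finset.sum_congr rfl fun i hi => ?_
  obtain ⟨hij, hi⟩ := Finset.mem_erase.mp hi
  rw [wedgeSign_erase hi, wedgeSign_erase hj, ← neg_smul]
  congr 1
  rcases lt_or_gt_of_ne hij with h | h
  · rw [if_pos h, if_neg h.asymm]; ring
  · rw [if_neg h.asymm, if_pos h]; ring

lemma sum_symm_eq_zero (J : Finset (Fin n)) (G : Fin n → Fin n → ConvPS n)
    (hG : ∀ i j, G i j = G j i) :
    ∑ i ∈ J, ∑ j ∈ J.erase i, (wedgeSign i J * wedgeSign j (J.erase i)) • G i j = 0 := by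
  have h := sum_swap J G
  simp only [← hG] at h
  have h2 : (2 : ℂ) • ∑ i ∈ J, ∑ j ∈ J.erase i,
      (wedgeSign i J * wedgeSign j (J.erase i)) • G i j = 0 := by
    rw [two_smul]
    nth_rewrite 1 [h]
    exact neg_add_cancel _
  exact (smul_eq_zero.mp h2).resolve_left two_ne_zero

lemma dfWedge_dfWedge (f : ConvPS n) (ω : Form n) : dfWedge f (dfWedge f ω) = 0 := by
  funext J
  rw [dfWedge_apply]
  simp only [dfWedge_apply, Finset.mul_sum, Finset.smul_sum, mul_smul_comm, smul_smul]
  refine sum_symm_eq_zero J (fun i j => partialD i f * (partialD j f * ω ((J.erase i).erase j))) ?_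
  intro i j
  rw [Finset.erase_right_comm]
  ring

lemma extD_dfWedge (f : ConvPS n) (ω : Form n) :
    extD (dfWedge f ω) = -dfWedge f (extD ω) := by
  funext J
  rw [Pi.neg_apply, extD_apply, dfWedge_apply]
  simp only [dfWedge_apply, extD_apply, Finset.mul_sum, Finset.smul_sum, mul_smul_comm, smul_smul,
    map_sum, map_zsmul, partialD_mul, smul_add, Finset.sum_add_distrib]
  rw [sum_symm_eq_zero J
    (fun i j => partialD i (partialD j f) * ω ((J.erase i).erase j)), add_zero,
    sum_swap J (fun i j => partialD j f * partialD i (ω ((J.erase i).erase j)))]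
  · simp only [Finset.erase_right_comm]
  · intro i j
    rw [Finset.erase_right_comm, partialD_comm]

/-! ### The Brieskorn lattice -/

/-- The subspace `df ∧ dΩⁿ⁻²` of `Ωⁿ`. -/
def relations (f : ConvPS n) : Submodule ℂ (formsOfDegree n n) :=
  (((formsOfDegree n (n - 2)).restrictScalars ℂ).map
    (((dfWedge f).restrictScalars ℂ) ∘ₗ extD)).comap
      ((formsOfDegree n n).subtype.restrictScalars ℂ)

/-- The Brieskorn lattice `H'' = Ωⁿ / df ∧ dΩⁿ⁻²`. -/
abbrev BrieskornLattice (f : ConvPS n) : Type := formsOfDegree n n ⧸ relations f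

/-- The class `[ω] ∈ H''` of a form `ω ∈ Ωⁿ`. -/
abbrev formClass (f : ConvPS n) : formsOfDegree n n →ₗ[ℂ] BrieskornLattice f :=
  (relations f).mkQ

lemma mem_relations (f : ConvPS n) (α : formsOfDegree n n) :
    α ∈ relations f ↔ ∃ ξ ∈ formsOfDegree n (n - 2), dfWedge f (extD ξ) = α := Iff.rfl

lemma dfWedge_mem_relations (hn : 2 ≤ n) (f : ConvPS n) {η ξ : Form n}
    (hη : η ∈ formsOfDegree n (n - 1)) (hξ : ξ ∈ formsOfDegree n (n - 2))
    (h : dfWedge f (extD ξ) = extD η) :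
    ∃ ζ ∈ formsOfDegree n (n - 2), dfWedge f (extD ζ) = dfWedge f η := by
  have e : n - 1 = n - 2 + 1 := by omega
  rw [e] at hη
  obtain ⟨ζ, hζ, h'⟩ := exists_extD_eq (add_mem hη (dfWedge_mem f hξ)) (by
    rw [map_add, extD_dfWedge, h, add_neg_cancel])
  exact ⟨ζ, hζ, by rw [h', map_add, dfWedge_dfWedge, add_zero]⟩

/-- The form `df ∧ η`, where `η` is the standard primitive of `ω ∈ Ωⁿ`. -/
def dfWedgePrimitive (hn : 2 ≤ n) (f : ConvPS n) : formsOfDegree n n →ₗ[ℂ] formsOfDegree n n where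
  toFun ω := ⟨dfWedge f (contract (divForm ω)), by
    have e : n = n - 1 + 1 := by omega
    have h := divForm_mem ω.2
    have h' : divForm ω.1 ∈ formsOfDegree n (n - 1 + 1) := by rwa [← e]
    have := dfWedge_mem f (contract_mem h')
    rwa [← e] at this⟩
  map_add' ω η := Subtype.ext (by simp)
  map_smul' c ω := Subtype.ext (by
    change dfWedge f (contract (divForm (c • ω.1))) = c • dfWedge f (contract (divForm ω.1))
    rw [map_smul, LinearMap.map_smul_of_tower, LinearMap.map_smul_of_tower])

lemma primitive_mem (hn : 2 ≤ n) (ω : formsOfDegree n n) :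
    contract (divForm ω.1) ∈ formsOfDegree n (n - 1) := by
  have e : n = n - 1 + 1 := by omega
  have h := divForm_mem ω.2
  exact contract_mem (by rwa [← e])

lemma extD_primitive (hn : 2 ≤ n) (ω : formsOfDegree n n) :
    extD (contract (divForm ω.1)) = ω.1 := by
  have := homotopy (by omega) ω.2
  rwa [extD_top ω.2, map_zero, map_zero, add_zero] at this

/-- There is exactly one linear operator `s` on `H''` with `s [dη] = [df ∧ η]` for all
`η ∈ Ωⁿ⁻¹`. -/
theorem existsUnique_s (hn : 2 ≤ n) (f : ConvPS n) :
    ∃! s : Module.End ℂ (BrieskornLattice f), ∀ η ∈ formsOfDegree n (n - 1),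
      ∀ α β : formsOfDegree n n, (α : Form n) = extD η → (β : Form n) = dfWedge f η →
        s (formClass f α) = formClass f β := by
  have key : ∀ η ∈ formsOfDegree n (n - 1),
      ∀ α β : formsOfDegree n n, (α : Form n) = extD η → (β : Form n) = dfWedge f η →
        formClass f (dfWedgePrimitive hn f α) = formClass f β := by
    intro η hη α β hα hβ
    rw [← sub_eq_zero, ← map_sub]
    refine (Submodule.Quotient.mk_eq_zero _).mpr ((mem_relations f _).mpr ?_)
    obtain ⟨ζ, hζ, h⟩ := dfWedge_mem_relations hn f (sub_mem (primitive_mem hn α) hη)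
      (zero_mem _) (by rw [map_zero, map_zero, map_sub, extD_primitive hn, hα, sub_self])
    refine ⟨ζ, hζ, ?_⟩
    rw [h, map_sub, ← hβ]
    rfl
  refine ⟨(relations f).liftQ (formClass f ∘ₗ dfWedgePrimitive hn f) ?_, ?_, ?_⟩
  · intro α hα
    obtain ⟨ξ, hξ, h⟩ := (mem_relations f α).mp hα
    refine (Submodule.Quotient.mk_eq_zero _).mpr ((mem_relations f _).mpr ?_)
    exact dfWedge_mem_relations hn f (primitive_mem hn α) hξ (by rw [extD_primitive hn, h])
  · intro η hη α β hα hβ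
    exact key η hη α β hα hβ
  · intro s hs
    refine LinearMap.ext fun h => ?_
    obtain ⟨α, rfl⟩ := Submodule.Quotient.mk_surjective _ h
    exact hs _ (primitive_mem hn α) α (dfWedgePrimitive hn f α) (extD_primitive hn α).symm rfl

/-- The operator `s` on the Brieskorn lattice, `s [dη] = [df ∧ η]`. -/
def sOp (hn : 2 ≤ n) (f : ConvPS n) : Module.End ℂ (BrieskornLattice f) :=
  (existsUnique_s hn f).choose

lemma sOp_formClass (hn : 2 ≤ n) (f : ConvPS n) (ω : formsOfDegree n n) :
    sOp hn f (formClass f ω) = formClass f (dfWedgePrimitive hn f ω) :=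
  (existsUnique_s hn f).choose_spec.1 _ (primitive_mem hn ω) ω (dfWedgePrimitive hn f ω)
    (extD_primitive hn ω).symm rfl

/-- The image of `⟨x⟩ᵏ Ωⁿ` in `H''`. -/
def xSub (f : ConvPS n) (k : ℕ) : Submodule ℂ (BrieskornLattice f) :=
  ((maxIdeal n ^ k • (⊤ : Submodule (ConvPS n) (formsOfDegree n n))).restrictScalars ℂ).map
    (formClass f)

/-- The image `sᵏ H''` of `sᵏ`. -/
def sSub (hn : 2 ≤ n) (f : ConvPS n) (k : ℕ) : Submodule ℂ (BrieskornLattice f) :=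
  LinearMap.range (sOp hn f ^ k)

lemma divWeight_coord_mul (w : ℕ) (i : Fin n) (g : ConvPS n) :
    divWeight w (coord i * g) = coord i * divWeight (w + 1) g := by
  refine ConvPS.ext fun m => ?_
  rw [coeff_divWeight, coeff_coord_mul, coeff_coord_mul]
  split_ifs with h
  · simp
  · rw [coeff_divWeight]
    have : (m - Finsupp.single i 1).degree + 1 = m.degree := by
      conv_rhs => rw [← tsub_add_cancel_of_le (show Finsupp.single i 1 ≤ m by
        simpa using Nat.one_le_iff_ne_zero.mpr h), map_add, Finsupp.degree_single]
    rw [← this]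
    congr 3
    omega

lemma divWeight_mem (k : ℕ) : ∀ (w : ℕ) {g : ConvPS n}, g ∈ maxIdeal n ^ k →
    divWeight w g ∈ maxIdeal n ^ k := by
  induction k with
  | zero => intro w g _; simp
  | succ k ih =>
    intro w g hg
    rw [pow_succ'] at hg
    refine Submodule.mul_induction_on hg (fun a ha b hb => ?_)
      (fun a b ha hb => by rw [map_add]; exact add_mem ha hb)
    have H : ∀ b ∈ maxIdeal n ^ k, divWeight w (a * b) ∈ maxIdeal n ^ (k + 1) := by
      refine Submodule.span_induction
        (p := fun a _ => ∀ b ∈ maxIdeal n ^ k, divWeight w (a * b) ∈ maxIdeal n ^ (k + 1))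
        ?_ ?_ ?_ ?_ ha
      · rintro _ ⟨i, rfl⟩ b hb
        rw [divWeight_coord_mul, pow_succ']
        exact Ideal.mul_mem_mul (Ideal.subset_span ⟨i, rfl⟩) (ih _ hb)
      · intro b _; rw [zero_mul, map_zero]; exact zero_mem _
      · intro x y _ _ hx hy b hb
        rw [add_mul, map_add]
        exact add_mem (hx b hb) (hy b hb)
      · intro c x _ hx b hb
        rw [smul_eq_mul, mul_right_comm, mul_comm, ← mul_assoc, mul_assoc, mul_comm]
        have := hx (c * b) (Ideal.mul_mem_left _ c hb)
        convert this using 2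
        ring
    exact H b hb

lemma mem_pow_smul_top (I : Ideal (ConvPS n)) (α : formsOfDegree n n) :
    α ∈ I • (⊤ : Submodule (ConvPS n) (formsOfDegree n n)) ↔ ∀ J, (α : Form n) J ∈ I := by
  constructor
  · intro h J
    refine Submodule.smul_induction_on h (fun a ha β _ => ?_) (fun β γ hβ hγ => add_mem hβ hγ)
    exact Ideal.mul_mem_right _ _ ha
  · intro h
    have e : α = (α : Form n) Finset.univ • (⟨fun J => if J = Finset.univ then 1 else 0, by
        intro J hJ
        refine if_neg ?_
        rintro rfl
        simp at hJ⟩ : formsOfDegree n n) := by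
      refine Subtype.ext (funext fun J => ?_)
      change _ = α.1 Finset.univ * (if J = Finset.univ then 1 else 0)
      split_ifs with hJ
      · rw [hJ, mul_one]
      · rw [mul_zero]
        refine α.2 J fun hc => hJ ?_
        rw [← Finset.card_eq_iff_eq_univ, hc, Fintype.card_fin]
    rw [e]
    exact Submodule.smul_mem_smul (h _) trivial

lemma sOp_xSub (hn : 2 ≤ n) (f : ConvPS n) (k : ℕ) {h : BrieskornLattice f} (hh : h ∈ xSub f k) :
    sOp hn f h ∈ xSub f (k + 1) := by
  obtain ⟨ω, hω, rfl⟩ := hh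
  rw [sOp_formClass]
  refine ⟨_, ?_, rfl⟩
  replace hω := (mem_pow_smul_top _ ω).mp hω
  refine (mem_pow_smul_top _ _).mpr fun J => ?_
  change dfWedge f (contract (divForm ω.1)) J ∈ _
  rw [dfWedge_apply]
  refine sum_mem fun i _ => zsmul_mem (Ideal.mul_mem_left _ _ ?_) _
  rw [contract_apply]
  refine sum_mem fun j _ => zsmul_mem ?_ _
  rw [pow_succ']
  exact Ideal.mul_mem_mul (Ideal.subset_span ⟨j, rfl⟩) (divWeight_mem k _ (hω _))

/-! ### Topologies and completions -/

/-- The `⟨x⟩`-adic topology on `H''`: the quotient of the `⟨x⟩`-adic topology on `Ωⁿ`. -/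
@[reducible]
def xAdicTopology (f : ConvPS n) : TopologicalSpace (BrieskornLattice f) :=
  TopologicalSpace.coinduced (formClass f) ((maxIdeal n).adicModuleTopology (formsOfDegree n n))

/-- The `⟨s⟩`-adic topology on `H''`, that is, the adic topology for the ideal `⟨s⟩` of `ℂ[s]`,
where `H''` is a `ℂ[s]`-module through the operator `s`. -/
@[reducible]
def sAdicTopology (hn : 2 ≤ n) (f : ConvPS n) : TopologicalSpace (BrieskornLattice f) :=
  TopologicalSpace.induced (Module.AEval'.of (sOp hn f))
    ((Ideal.span {(Polynomial.X : Polynomial ℂ)}).adicModuleTopology (Module.AEval' (sOp hn f)))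

/-- A decreasing filtration `H = F 0 ⊇ F 1 ⊇ ⋯` with `s (F k) ⊆ F (k + 1)`. -/
structure SFiltration {H : Type} [AddCommGroup H] [Module ℂ H] (s : Module.End ℂ H) where
  F : ℕ → Submodule ℂ H
  zero : F 0 = ⊤
  anti : ∀ {i j : ℕ}, i ≤ j → F j ≤ F i
  step : ∀ k, ∀ h ∈ F k, s h ∈ F (k + 1)

namespace SFiltration

variable {H : Type} [AddCommGroup H] [Module ℂ H] {s : Module.End ℂ H} (𝓕 : SFiltration s)

/-- The projective limit of the quotients `H / F k`, as a submodule of their product. -/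
def limit : Submodule ℂ (∀ k, H ⧸ 𝓕.F k) where
  carrier := {y | ∀ i j (hij : i ≤ j), Submodule.factor (𝓕.anti hij) (y j) = y i}
  add_mem' hy hz i j hij := by simp [hy i j hij, hz i j hij]
  zero_mem' i j hij := by simp
  smul_mem' c y hy i j hij := by simp [hy i j hij]

/-- The completion `lim H / F k` of `H`. -/
def Completion : Type := 𝓕.limit

instance : AddCommGroup 𝓕.Completion := inferInstanceAs (AddCommGroup 𝓕.limit)

/-- The canonical map from `H` to its completion. -/
def of : H →+ 𝓕.Completion where
  toFun h := (⟨fun k => (𝓕.F k).mkQ h, fun _ _ _ => Submodule.factor_mk _ h⟩ : 𝓕.limit)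
  map_zero' := rfl
  map_add' _ _ := rfl

/-- The operator induced by `s` on `H / F k`. -/
def sQuot (k : ℕ) : Module.End ℂ (H ⧸ 𝓕.F k) :=
  (𝓕.F k).mapQ (𝓕.F k) s fun h hh => 𝓕.anti (Nat.le_succ k) (𝓕.step k h hh)

lemma pow_mem (k : ℕ) (h : H) : (s ^ k) h ∈ 𝓕.F k := by
  induction k with
  | zero => rw [𝓕.zero]; trivial
  | succ k ih => rw [pow_succ']; exact 𝓕.step k _ ih

lemma sQuot_pow (k : ℕ) : 𝓕.sQuot k ^ k = 0 := by
  rw [sQuot, ← Submodule.mapQ_pow]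
  refine Submodule.linearMap_qext _ (LinearMap.ext fun h => ?_)
  exact (Submodule.Quotient.mk_eq_zero _).mpr (𝓕.pow_mem k h)

lemma aeval_congr {i : ℕ} {p q : Polynomial ℂ} (h : ∀ d < i, p.coeff d = q.coeff d) :
    Polynomial.aeval (𝓕.sQuot i) p = Polynomial.aeval (𝓕.sQuot i) q := by
  obtain ⟨r, hr⟩ : Polynomial.X ^ i ∣ p - q :=
    Polynomial.X_pow_dvd_iff.mpr fun d hd => by rw [Polynomial.coeff_sub, h d hd, sub_self]
  rw [← sub_eq_zero, ← map_sub, hr, map_mul, map_pow, Polynomial.aeval_X, sQuot_pow, zero_mul]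

lemma factor_aeval {i j : ℕ} (hij : i ≤ j) (p : Polynomial ℂ) (y : H ⧸ 𝓕.F j) :
    Submodule.factor (𝓕.anti hij) (Polynomial.aeval (𝓕.sQuot j) p y)
      = Polynomial.aeval (𝓕.sQuot i) p (Submodule.factor (𝓕.anti hij) y) := by
  induction p using Polynomial.induction_on generalizing y with
  | C c => simp [Module.algebraMap_end_apply]
  | add p q hp hq => simp [hp, hq]
  | monomial d c ih =>
    rw [pow_succ, ← mul_assoc, map_mul _ _ Polynomial.X, map_mul _ _ Polynomial.X,
      Polynomial.aeval_X, Polynomial.aeval_X,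
      Module.End.mul_apply, Module.End.mul_apply, ih]
    congr 1
    obtain ⟨h, rfl⟩ := Submodule.Quotient.mk_surjective _ y
    rfl

/-- The power series `a = ∑ aᵢ sⁱ` acts on `H / F k` as the finite sum `∑_{i < k} aᵢ sⁱ`, because
`sᵏ` is zero there; this makes the completion a `ℂ⟦s⟧`-module. -/
instance : SMul (PowerSeries ℂ) 𝓕.Completion where
  smul a y := (⟨fun k => Polynomial.aeval (𝓕.sQuot k) (PowerSeries.trunc k a) (y.1 k), by
    intro i j hij
    rw [𝓕.factor_aeval hij, y.2 i j hij]
    congr 1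
    refine 𝓕.aeval_congr fun d hd => ?_
    rw [PowerSeries.coeff_trunc, PowerSeries.coeff_trunc, if_pos hd, if_pos (hd.trans_le hij)]⟩ :
      𝓕.limit)

lemma smul_val (a : PowerSeries ℂ) (y : 𝓕.Completion) (k : ℕ) :
    (a • y).1 k = Polynomial.aeval (𝓕.sQuot k) (PowerSeries.trunc k a) (y.1 k) := rfl

lemma completion_ext {y z : 𝓕.Completion} (h : ∀ k, y.1 k = z.1 k) : y = z :=
  Subtype.ext (funext h)

instance : Module (PowerSeries ℂ) 𝓕.Completion where
  one_smul y := 𝓕.completion_ext fun k => by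
    rw [smul_val, 𝓕.aeval_congr (q := 1), map_one, Module.End.one_apply]
    intro d hd
    rw [PowerSeries.coeff_trunc, if_pos hd, PowerSeries.coeff_one, Polynomial.coeff_one]
  mul_smul a b y := 𝓕.completion_ext fun k => by
    rw [smul_val, smul_val, smul_val, ← Module.End.mul_apply, ← map_mul]
    congr 1
    refine 𝓕.aeval_congr fun d hd => ?_
    rw [PowerSeries.coeff_trunc, if_pos hd, PowerSeries.coeff_mul_eq_coeff_trunc_mul_trunc a b hd,
      ← Polynomial.coe_mul, Polynomial.coeff_coe]
  smul_zero a := 𝓕.completion_ext fun k => map_zero _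
  smul_add a y z := 𝓕.completion_ext fun k => map_add _ _ _
  add_smul a b y := 𝓕.completion_ext fun k => by
    rw [smul_val, map_add, map_add]; rfl
  zero_smul y := 𝓕.completion_ext fun k => by
    rw [smul_val, map_zero, map_zero]; rfl

/-- On the image of `H`, the power series `X` acts as the operator `s`. -/
lemma X_smul_of (h : H) : (PowerSeries.X : PowerSeries ℂ) • 𝓕.of h = 𝓕.of (s h) :=
  𝓕.completion_ext fun k => by
    rw [smul_val, 𝓕.aeval_congr (q := Polynomial.X), Polynomial.aeval_X]
    · rfl
    · intro d hd
      rw [PowerSeries.coeff_trunc, if_pos hd, PowerSeries.coeff_X, Polynomial.coeff_X]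
      simp only [eq_comm]

end SFiltration

/-- The filtration of `H''` by the images of `⟨x⟩ᵏ Ωⁿ`. -/
def xFiltration (hn : 2 ≤ n) (f : ConvPS n) : SFiltration (sOp hn f) where
  F := xSub f
  zero := by
    rw [xSub, pow_zero, Ideal.one_eq_top, Submodule.top_smul, Submodule.restrictScalars_top,
      Submodule.map_top, Submodule.range_mkQ]
  anti := fun hij => Submodule.map_mono fun _ h =>
    Submodule.smul_mono_left (Ideal.pow_le_pow_right hij) h
  step := fun k _ h => sOp_xSub hn f k h

/-- The filtration of `H''` by the subspaces `⟨s⟩ᵏ H'' = sᵏ H''`. -/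
def sFiltration (hn : 2 ≤ n) (f : ConvPS n) : SFiltration (sOp hn f) where
  F := sSub hn f
  zero := by rw [sSub, pow_zero]; exact LinearMap.range_id
  anti := @(antitone_nat_of_succ_le fun k => by
    rintro _ ⟨h, rfl⟩
    exact ⟨sOp hn f h, by rw [pow_succ]; rfl⟩)
  step := by
    rintro k _ ⟨h, rfl⟩
    exact ⟨h, by rw [pow_succ']; rfl⟩

/-- The formal Brieskorn lattice `Ĥ''`: the `⟨x⟩`-adic completion of `H''`. -/
abbrev FormalBrieskornLattice (hn : 2 ≤ n) (f : ConvPS n) : Type := (xFiltration hn f).Completion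

/-- The `⟨s⟩`-adic completion of `H''`. -/
abbrev SAdicCompletion (hn : 2 ≤ n) (f : ConvPS n) : Type := (sFiltration hn f).Completion

end Brieskorn

end

noncomputable section

namespace Brieskorn

variable {n : ℕ}

/-! Applying `s` raises the `⟨x⟩`-order by one, which gives `sᵏH'' ⊆ X_k`. Conversely, if `⟨x⟩^m ⊆
⟨∂(f)⟩`, a top form with coefficient in `⟨x⟩^(k+1+m)` equals `df ∧ η` with `η` in `⟨x⟩^(k+1)`; its
class is `s[dη]`, and `dη` lies in `⟨x⟩^k` (`exists_sOp_eq_of_mem_xSub`). Undoing `s` thus costs `m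
+ 1 ≤ 2m` orders. The two filtrations interlace, so topologies and completions agree.

Freeness is proved for the `s`-adic completion from two facts: `H''/sH''` is the Milnor algebra
(`ker_toMilnor`), and `s` is injective (`sOp_injective`). They make the completion `X`-torsion-free,
with every element that vanishes in `H''/sH''` divisible by `X`; lifts of a basis of `H''/sH''` then
form a `ℂ⟦s⟧`-basis by successive approximation (`SFiltration.nonempty_completion_equiv_pi`).

Injectivity of `s` rests on the de Rham lemma for `df` (`exists_dfWedge_eq`). Write `xᵢ^m = ∑ⱼ aⱼ
∂ⱼ(f)`. Contraction with `a` is a homotopy on the Koszul complex between zero and multiplication by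
`xᵢ^m`. Exactness follows by induction on the degree: each step down adds one more `xᵢ^m` to the
ideal modulo which one works. That these powers form a regular sequence is read off from monomials.
-/

/-! ### Division by powers of the coordinates -/

/-- The series whose coefficients vanish at all `x^a` with `a i < m` for every `i ∈ S`. This is the
ideal generated by the `xᵢ^m` with `i ∈ S`. -/
def monomialIdeal (m : ℕ) (S : Finset (Fin n)) : Ideal (ConvPS n) where
  carrier := {g | ∀ a : Fin n →₀ ℕ, (∀ i ∈ S, a i < m) → MvPowerSeries.coeff a g.1 = 0}
  add_mem' {g h} hg hh a ha := by
    change MvPowerSeries.coeff a (g.1 + h.1) = 0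
    rw [map_add, hg a ha, hh a ha, add_zero]
  zero_mem' a _ := map_zero (MvPowerSeries.coeff a)
  smul_mem' c g hg a ha := by
    change MvPowerSeries.coeff a (c.1 * g.1) = 0
    rw [MvPowerSeries.coeff_mul]
    refine Finset.sum_eq_zero fun p hp => ?_
    rw [hg p.2 fun i hi => lt_of_le_of_lt ?_ (ha i hi), mul_zero]
    rw [← Finset.HasAntidiagonal.mem_antidiagonal.mp hp, Finsupp.add_apply]
    exact Nat.le_add_left _ _

lemma coeff_coord_pow_mul (i : Fin n) (m : ℕ) (g : ConvPS n) (a : Fin n →₀ ℕ) :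
    MvPowerSeries.coeff a (coord i ^ m * g).1 =
      if m ≤ a i then MvPowerSeries.coeff (a - Finsupp.single i m) g.1 else 0 := by
  change MvPowerSeries.coeff a (MvPowerSeries.X i ^ m * g.1) = _
  rw [MvPowerSeries.X_pow_eq, MvPowerSeries.coeff_monomial_mul]
  simp only [one_mul, Finsupp.single_le_iff]

lemma isConvergent_quotX (i : Fin n) (m : ℕ) {g : MvPowerSeries (Fin n) ℂ} (hg : IsConvergent g) :
    IsConvergent (fun a => MvPowerSeries.coeff (a + Finsupp.single i m) g :
      MvPowerSeries (Fin n) ℂ) := by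
  obtain ⟨r, hr, hs⟩ := hg
  refine ⟨r, hr, ((hs.comp_injective
    (add_left_injective (Finsupp.single i m))).mul_left (r ^ m)⁻¹).congr fun a => ?_⟩
  change _ = ‖MvPowerSeries.coeff (a + Finsupp.single i m) g‖ * r ^ a.degree
  simp only [Function.comp_apply, map_add, Finsupp.degree_single, pow_add]
  field_simp

/-- The quotient of the division by `xᵢ^m`. -/
def quotX (i : Fin n) (m : ℕ) : ConvPS n →ₗ[ℂ] ConvPS n where
  toFun g := ⟨_, isConvergent_quotX i m g.2⟩
  map_add' _ _ := rfl
  map_smul' _ _ := rfl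

lemma coeff_quotX (i : Fin n) (m : ℕ) (g : ConvPS n) (a : Fin n →₀ ℕ) :
    MvPowerSeries.coeff a (quotX i m g).1 = MvPowerSeries.coeff (a + Finsupp.single i m) g.1 := rfl

/-- Subtracting `xᵢ^m` times the quotient removes exactly the monomials with exponent at least `m`
in `xᵢ`. On the remaining ones, the condition at `i` holds automatically. -/
lemma sub_quotX_mem {i : Fin n} {m : ℕ} {S : Finset (Fin n)} {g : ConvPS n}
    (hg : g ∈ monomialIdeal m (insert i S)) :
    g - coord i ^ m * quotX i m g ∈ monomialIdeal m S := by
  intro a ha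
  change MvPowerSeries.coeff a (g.1 - (coord i ^ m * quotX i m g).1) = 0
  rw [map_sub, coeff_coord_pow_mul, coeff_quotX]
  split_ifs with h
  · rw [tsub_add_cancel_of_le (Finsupp.single_le_iff.mpr h), sub_self]
  · rw [sub_zero, hg a]
    simpa using ⟨not_le.mp h, ha⟩

lemma coord_pow_mem_monomialIdeal {i : Fin n} {S : Finset (Fin n)} (hi : i ∈ S) (m : ℕ) :
    coord i ^ m ∈ monomialIdeal m S := by
  intro a ha
  rw [← mul_one (coord i ^ m), coeff_coord_pow_mul, if_neg (not_le.mpr (ha i hi))]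

lemma monomialIdeal_mono (m : ℕ) {S T : Finset (Fin n)} (h : S ⊆ T) :
    monomialIdeal m S ≤ monomialIdeal (n := n) m T :=
  fun _ hg a ha => hg a fun i hi => ha i (h hi)

/-- Multiplication by `xᵢ^m` shifts only the exponent of `xᵢ`, which the ideal ignores when `i ∉ S`.
This is the regularity of the sequence of the `xᵢ^m`. -/
lemma mem_monomialIdeal_of_coord_pow_mul {i : Fin n} {m : ℕ} {S : Finset (Fin n)} (hi : i ∉ S)
    {g : ConvPS n} (h : coord i ^ m * g ∈ monomialIdeal m S) : g ∈ monomialIdeal m S := by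
  intro a ha
  have := h (a + Finsupp.single i m) fun j hj => by
    have hij : i ≠ j := by rintro rfl; exact hi hj
    simpa [Finsupp.single_apply, hij] using ha j hj
  rwa [coeff_coord_pow_mul, if_pos (by simp), add_tsub_cancel_right] at this

lemma monomialIdeal_empty (m : ℕ) : monomialIdeal m (∅ : Finset (Fin n)) = ⊥ :=
  (Submodule.eq_bot_iff _).mpr fun _ hg => ConvPS.ext fun a => hg a (by simp)

lemma monomialIdeal_le_span (m : ℕ) (S : Finset (Fin n)) :
    monomialIdeal m S ≤ Ideal.span (Set.range fun i => coord i ^ m) := by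
  induction S using Finset.induction_on with
  | empty => rw [monomialIdeal_empty]; exact bot_le
  | insert i S _ ih =>
    intro g hg
    rw [← sub_add_cancel g (coord i ^ m * quotX i m g)]
    exact add_mem (ih (sub_quotX_mem hg)) (Ideal.mul_mem_right _ _ (Ideal.subset_span ⟨i, rfl⟩))

/-! ### Finiteness of the Milnor number -/

lemma exists_sub_const_mem (g : ConvPS n) : ∃ c : ℂ, g - algebraMap ℂ _ c ∈ maxIdeal n := by
  refine ⟨MvPowerSeries.constantCoeff g.1, ?_⟩
  -- For `m = 1` and all variables, the only exponent tested by the monomial ideal is `0`.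
  have h : g - algebraMap ℂ _ (MvPowerSeries.constantCoeff g.1)
      ∈ monomialIdeal 1 (Finset.univ : Finset (Fin n)) := by
    intro a ha
    have : a = 0 := Finsupp.ext fun i => by simpa using ha i (Finset.mem_univ i)
    subst this
    change MvPowerSeries.coeff 0 (g.1 - MvPowerSeries.C (MvPowerSeries.constantCoeff g.1)) = 0
    rw [map_sub, MvPowerSeries.coeff_zero_C, MvPowerSeries.coeff_zero_eq_constantCoeff_apply,
      sub_self]
  simpa [maxIdeal] using monomialIdeal_le_span 1 _ h

/-- Write `g = c + ∑ aᵢ xᵢ` and split each `aᵢ` by the previous stage: `ℂ·1 + ∑ xᵢ V` works for `k +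
1` if `V` works for `k`. -/
lemma exists_finite_complement (k : ℕ) : ∃ V : Submodule ℂ (ConvPS n), Module.Finite ℂ V ∧
    V ⊔ (maxIdeal n ^ k).restrictScalars ℂ = ⊤ := by
  induction k with
  | zero => exact ⟨⊥, inferInstance, by simp⟩
  | succ k ih =>
    obtain ⟨V, hV, h⟩ := ih
    refine ⟨Submodule.span ℂ {1} ⊔ ⨆ i, V.map (LinearMap.mulLeft ℂ (coord i)), ?_, ?_⟩
    · infer_instance
    · refine eq_top_iff.mpr fun g _ => ?_
      obtain ⟨c, hc⟩ := exists_sub_const_mem g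
      rw [← sub_add_cancel g (algebraMap ℂ _ c)]
      refine add_mem ?_ (Submodule.mem_sup_left (Submodule.mem_sup_left ?_))
      · obtain ⟨a, ha⟩ := Ideal.mem_span_range_iff_exists_fun.mp hc
        rw [← ha]
        refine sum_mem fun i _ => ?_
        obtain ⟨v, hv, w, hw, e⟩ := Submodule.mem_sup.mp (h ▸ Submodule.mem_top : a i ∈ _)
        rw [← e, mul_comm, mul_add]
        refine add_mem (Submodule.mem_sup_left (Submodule.mem_sup_right ?_))
          (Submodule.mem_sup_right ?_)
        · exact Submodule.mem_iSup_of_mem i ⟨v, hv, rfl⟩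
        · change coord i * w ∈ maxIdeal n ^ (k + 1)
          rw [pow_succ']
          exact Ideal.mul_mem_mul (Ideal.subset_span ⟨i, rfl⟩) hw
      · rw [Algebra.algebraMap_eq_smul_one]
        exact Submodule.smul_mem _ _ (Submodule.mem_span_singleton_self _)

lemma finite_milnorAlgebra {f : ConvPS n} {m : ℕ} (hm : maxIdeal n ^ m ≤ jacobianIdeal f) :
    Module.Finite ℂ (MilnorAlgebra f) := by
  obtain ⟨V, hV, h⟩ := exists_finite_complement (n := n) m
  let q : V →ₗ[ℂ] MilnorAlgebra f :=
    (Ideal.Quotient.mkₐ ℂ (jacobianIdeal f)).toLinearMap ∘ₗ V.subtype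
  refine Module.Finite.of_surjective q fun y => ?_
  obtain ⟨g, rfl⟩ := Ideal.Quotient.mk_surjective y
  obtain ⟨v, hv, w, hw, rfl⟩ := Submodule.mem_sup.mp (h ▸ Submodule.mem_top : g ∈ _)
  refine ⟨⟨v, hv⟩, ?_⟩
  change Ideal.Quotient.mk _ v = _
  rw [map_add, Ideal.Quotient.eq_zero_iff_mem.mpr (hm hw), add_zero]

/-! ### The Koszul complex of the partial derivatives -/

/-- Contraction with the vector field `∑ aᵢ ∂ᵢ`. -/
def contractBy (a : Fin n → ConvPS n) (ω : Form n) : Form n :=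
  fun J => ∑ i ∈ Jᶜ, wedgeSign i J • (a i * ω (insert i J))

lemma contractBy_apply (a : Fin n → ConvPS n) (ω : Form n) (J : Finset (Fin n)) :
    contractBy a ω J = ∑ i ∈ Jᶜ, wedgeSign i J • (a i * ω (insert i J)) := rfl

/-- Contraction is an antiderivation. Terms that remove and reinsert the same index add up to the
right-hand side; mixed terms cancel in pairs. -/
lemma dfWedge_contractBy_add (f : ConvPS n) (a : Fin n → ConvPS n) (ω : Form n)
    (J : Finset (Fin n)) :
    dfWedge f (contractBy a ω) J + contractBy a (dfWedge f ω) J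
      = (∑ i, a i * partialD i f) * ω J := by
  have h1 : dfWedge f (contractBy a ω) J = ∑ i ∈ J, (a i * partialD i f * ω J
      + ∑ j ∈ Jᶜ, (wedgeSign i J * wedgeSign j (J.erase i)) •
        (a j * partialD i f * ω (insert j (J.erase i)))) := by
    rw [dfWedge_apply]
    refine Finset.sum_congr rfl fun i hi => ?_
    rw [contractBy_apply, Finset.compl_erase, Finset.sum_insert (by simpa using hi),
      Finset.insert_erase hi, mul_add, smul_add, mul_smul_comm, smul_smul, wedgeSign_erase hi,
      if_neg (lt_irrefl i), wedgeSign_self_mul, one_smul, Finset.mul_sum, Finset.smul_sum]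
    congr 1
    · ring
    refine Finset.sum_congr rfl fun j hj => ?_
    rw [mul_smul_comm, smul_smul]
    congr 1
    ring
  have h2 : contractBy a (dfWedge f ω) J = ∑ j ∈ Jᶜ, (a j * partialD j f * ω J
      + ∑ i ∈ J, (wedgeSign j J * wedgeSign i (insert j J)) •
        (a j * partialD i f * ω (insert j (J.erase i)))) := by
    rw [contractBy_apply]
    refine Finset.sum_congr rfl fun j hj => ?_
    have hj' := Finset.mem_compl.mp hj
    rw [dfWedge_apply, Finset.sum_insert hj', Finset.erase_insert hj', mul_add, smul_add,
      wedgeSign_insert hj', if_neg (lt_irrefl j), mul_smul_comm, smul_smul, wedgeSign_self_mul,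
      one_smul, Finset.mul_sum, Finset.smul_sum]
    congr 1
    · ring
    refine Finset.sum_congr rfl fun i hi => ?_
    rw [mul_smul_comm, smul_smul, Finset.erase_insert_of_ne, mul_assoc]
    rintro rfl
    exact hj' hi
  have h3 : ∑ i ∈ J, ∑ j ∈ Jᶜ, (wedgeSign i J * wedgeSign j (J.erase i)) •
        (a j * partialD i f * ω (insert j (J.erase i)))
      + ∑ j ∈ Jᶜ, ∑ i ∈ J, (wedgeSign j J * wedgeSign i (insert j J)) •
        (a j * partialD i f * ω (insert j (J.erase i))) = 0 := by
    rw [Finset.sum_comm (s := Jᶜ), ← Finset.sum_add_distrib]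
    refine Finset.sum_eq_zero fun i hi => ?_
    rw [← Finset.sum_add_distrib]
    refine Finset.sum_eq_zero fun j hj => ?_
    have hj' := Finset.mem_compl.mp hj
    rw [← add_smul, wedgeSign_erase hi, wedgeSign_insert hj']
    have hij : i ≠ j := by rintro rfl; exact hj' hi
    -- Removing `i` flips the sign of `j` when `i < j`, and inserting `j` flips the sign of `i` when
    -- `j < i`: exactly one flip occurs.
    rcases lt_or_gt_of_ne hij with h | h
    · rw [if_pos h, if_neg h.asymm, show wedgeSign i J * -wedgeSign j J
        + wedgeSign j J * wedgeSign i J = 0 by ring, zero_smul]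
    · rw [if_neg h.asymm, if_pos h, show wedgeSign i J * wedgeSign j J
        + wedgeSign j J * -wedgeSign i J = 0 by ring, zero_smul]
  rw [h1, h2, Finset.sum_add_distrib, Finset.sum_add_distrib, Finset.sum_mul,
    ← Finset.sum_add_sum_compl J (fun i => a i * partialD i f * ω J)]
  linear_combination h3

lemma contractBy_mem_ideal {I : Ideal (ConvPS n)} {ω : Form n} (h : ∀ J, ω J ∈ I)
    (a : Fin n → ConvPS n) (J : Finset (Fin n)) : contractBy a ω J ∈ I :=
  sum_mem fun _ _ => zsmul_mem (Ideal.mul_mem_left _ _ (h _)) _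

lemma contractBy_mem_ideal_of_coeff {I : Ideal (ConvPS n)} {a : Fin n → ConvPS n}
    (h : ∀ i, a i ∈ I) (ω : Form n) (J : Finset (Fin n)) : contractBy a ω J ∈ I :=
  sum_mem fun _ _ => zsmul_mem (Ideal.mul_mem_right _ _ (h _)) _

lemma dfWedge_mem_ideal (f : ConvPS n) {I : Ideal (ConvPS n)} {ω : Form n} (h : ∀ J, ω J ∈ I)
    (J : Finset (Fin n)) : dfWedge f ω J ∈ I :=
  sum_mem fun _ _ => zsmul_mem (Ideal.mul_mem_left _ _ (h _)) _

/-- Contraction lowers the degree by one; in particular, it kills the forms of degree zero. -/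
lemma contractBy_eq_zero {p : ℕ} {ω : Form n} (h : ω ∈ formsOfDegree n p) (a : Fin n → ConvPS n)
    {J : Finset (Fin n)} (hJ : J.card + 1 ≠ p) : contractBy a ω J = 0 := by
  refine Finset.sum_eq_zero fun i hi => ?_
  rw [h (insert i J) (by rwa [Finset.card_insert_of_notMem (Finset.mem_compl.mp hi)]), mul_zero,
    smul_zero]

/-- The hypothesis means degree `p - 1` without truncated subtraction: for `p = 0` it forces `ω =
0`. -/
lemma dfWedge_eq_zero (f : ConvPS n) {p : ℕ} {ω : Form n} (h : ∀ J, J.card + 1 ≠ p → ω J = 0)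
    {J : Finset (Fin n)} (hJ : J.card ≠ p) : dfWedge f ω J = 0 := by
  refine Finset.sum_eq_zero fun i hi => ?_
  rw [h (J.erase i) (by rwa [Finset.card_erase_add_one hi]), mul_zero, smul_zero]

/-- Exactness of the Koszul complex of the partial derivatives, modulo the `xᵢ^m` with `i ∈ S`, in
the degrees below `n - #S`. -/
theorem exists_dfWedge_sub_mem {f : ConvPS n} {m : ℕ} (hm : ∀ i, coord i ^ m ∈ jacobianIdeal f)
    (p : ℕ) (S : Finset (Fin n)) (hS : S.card + p < n) {ω : Form n} (hω : ω ∈ formsOfDegree n p)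
    (h : ∀ J, dfWedge f ω J ∈ monomialIdeal m S) :
    ∃ θ : Form n, (∀ J, J.card + 1 ≠ p → θ J = 0) ∧
      ∀ J, ω J - dfWedge f θ J ∈ monomialIdeal m S := by
  induction p generalizing S ω with
  | zero =>
    obtain ⟨i, hi⟩ : ∃ i, i ∉ S := by
      by_contra! hc
      rw [Finset.eq_univ_of_forall hc] at hS
      simp at hS
    obtain ⟨a, ha⟩ := Ideal.mem_span_range_iff_exists_fun.mp (hm i)
    refine ⟨0, fun _ _ => rfl, fun J => ?_⟩
    rw [map_zero, Pi.zero_apply, sub_zero]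
    refine mem_monomialIdeal_of_coord_pow_mul hi ?_
    -- In degree zero the homotopy formula reduces to `xᵢ^m ω = ι_a(df ∧ ω)`, which lies in the
    -- ideal.
    have hz : contractBy a ω = 0 := funext fun J => contractBy_eq_zero hω a (by omega)
    have := dfWedge_contractBy_add f a ω J
    rw [hz, map_zero, Pi.zero_apply, zero_add, ha] at this
    exact this ▸ contractBy_mem_ideal h a J
  | succ p ih =>
    obtain ⟨i, hi⟩ : ∃ i, i ∉ S := by
      by_contra! hc
      rw [Finset.eq_univ_of_forall hc] at hS
      simp at hS
    obtain ⟨a, ha⟩ := Ideal.mem_span_range_iff_exists_fun.mp (hm i)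
    have hom := dfWedge_contractBy_add f a ω
    simp only [ha] at hom
    have hη : contractBy a ω ∈ formsOfDegree n p :=
      fun J hJ => contractBy_eq_zero hω a (by omega)
    -- The contraction has one degree less, and `df ∧ ι_a ω = xᵢ^m ω - ι_a(df ∧ ω)` vanishes modulo
    -- the ideal enlarged by `xᵢ^m`.
    obtain ⟨ζ, hζ, hζ'⟩ := ih (insert i S) (by
        rw [Finset.card_insert_of_notMem hi]; omega) hη fun J => by
      rw [eq_sub_of_add_eq (hom J)]
      exact sub_mem (Ideal.mul_mem_right _ _
        (coord_pow_mem_monomialIdeal (Finset.mem_insert_self i S) m))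
        (monomialIdeal_mono m (Finset.subset_insert i S) (contractBy_mem_ideal h a J))
    -- Division by `xᵢ^m` gives `ι_a ω = df ∧ ζ + xᵢ^m θ + ρ` with `ρ` in the ideal of `S` alone.
    -- Applying `df ∧` removes `ζ`, and cancelling `xᵢ^m` leaves `ω ≡ df ∧ θ`.
    set θ : Form n := fun J => quotX i m (contractBy a ω J - dfWedge f ζ J) with hθ
    set ρ : Form n := contractBy a ω - dfWedge f ζ - coord i ^ m • θ with hρ
    have hρ' : ∀ J, ρ J ∈ monomialIdeal m S := fun J => sub_quotX_mem (hζ' J)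
    refine ⟨θ, fun J hJ => ?_, fun J => ?_⟩
    · rw [hθ]
      simp only
      rw [hη J (by omega), dfWedge_eq_zero f hζ (by omega), sub_zero, map_zero]
    · refine mem_monomialIdeal_of_coord_pow_mul hi ?_
      have e : dfWedge f ρ = dfWedge f (contractBy a ω) - coord i ^ m • dfWedge f θ := by
        rw [hρ, map_sub, map_sub, dfWedge_dfWedge, map_smul, sub_zero]
      have e' := congrFun e J
      rw [Pi.sub_apply, Pi.smul_apply, smul_eq_mul] at e'
      rw [mul_sub, ← hom J]
      have : dfWedge f (contractBy a ω) J + contractBy a (dfWedge f ω) J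
          - coord i ^ m * dfWedge f θ J = dfWedge f ρ J + contractBy a (dfWedge f ω) J := by
        rw [e']; ring
      rw [this]
      exact add_mem (dfWedge_mem_ideal f hρ' J) (contractBy_mem_ideal h a J)

/-- The de Rham lemma: below the top degree, `df ∧ ω = 0` implies `ω = df ∧ θ`. -/
lemma exists_dfWedge_eq {f : ConvPS n} {m : ℕ} (hm : ∀ i, coord i ^ m ∈ jacobianIdeal f)
    {p : ℕ} (hp : p + 1 < n) {ω : Form n} (hω : ω ∈ formsOfDegree n (p + 1))
    (h : dfWedge f ω = 0) : ∃ θ ∈ formsOfDegree n p, dfWedge f θ = ω := by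
  obtain ⟨θ, hθ, e⟩ := exists_dfWedge_sub_mem hm (p + 1) ∅ (by simpa using hp) hω
    (fun J => by rw [h]; exact zero_mem _)
  refine ⟨θ, fun J hJ => hθ J (by omega), funext fun J => ?_⟩
  have := e J
  rw [monomialIdeal_empty, Ideal.mem_bot, sub_eq_zero] at this
  exact this.symm

/-! ### The operator `s` -/

lemma extD_extD (ω : Form n) : extD (extD ω) = 0 := by
  funext J
  rw [extD_apply]
  simp only [extD_apply, Finset.smul_sum, map_sum, map_zsmul, smul_smul]
  refine sum_symm_eq_zero J (fun i j => partialD i (partialD j (ω ((J.erase i).erase j)))) ?_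
  intro i j
  rw [Finset.erase_right_comm, partialD_comm]

/-- Allows any primitive in place of the standard one, so that `s[dη]` can be computed from a chosen
`η`. -/
lemma sOp_of_primitive (hn : 2 ≤ n) (f : ConvPS n) {η : Form n} (hη : η ∈ formsOfDegree n (n - 1))
    {α β : formsOfDegree n n} (hα : (α : Form n) = extD η) (hβ : (β : Form n) = dfWedge f η) :
    sOp hn f (formClass f α) = formClass f β :=
  (existsUnique_s hn f).choose_spec.1 η hη α β hα hβ

/-- An isolated critical point makes `s` injective on `H''`. -/
theorem sOp_injective (hn : 2 ≤ n) {f : ConvPS n} {m : ℕ}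
    (hm : ∀ i, coord i ^ m ∈ jacobianIdeal f) : Function.Injective (sOp hn f) := by
  refine (injective_iff_map_eq_zero _).mpr fun h hh => ?_
  obtain ⟨ω, rfl⟩ := (relations f).mkQ_surjective h
  rw [sOp_formClass] at hh
  obtain ⟨ξ, hξ, e⟩ := (mem_relations f _).mp ((Submodule.Quotient.mk_eq_zero _).mp hh)
  change dfWedge f (extD ξ) = dfWedge f (contract (divForm ω.1)) at e
  have hdeg : n - 2 + 1 = n - 1 := by omega
  -- With `η` the standard primitive of `ω`, the vanishing of `s[ω]` says `df ∧ (η - dξ) = 0`, so `η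
  -- - dξ = df ∧ θ`. Hence `ω = dη = d(df ∧ θ) = df ∧ d(-θ)` is a relation.
  obtain ⟨θ, hθ, e'⟩ := exists_dfWedge_eq hm (p := n - 2) (by omega)
    (ω := contract (divForm ω.1) - extD ξ)
    (by rw [hdeg]; exact sub_mem (primitive_mem hn ω) (hdeg ▸ extD_mem hξ))
    (by rw [map_sub, e, sub_self])
  refine (Submodule.Quotient.mk_eq_zero _).mpr ((mem_relations f _).mpr ⟨-θ, neg_mem hθ, ?_⟩)
  rw [map_neg, map_neg, ← extD_dfWedge, e', map_sub, extD_extD, sub_zero, extD_primitive hn]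

/-! ### Forms of top degree -/

/-- The form `g dx₁ ∧ ⋯ ∧ dxₙ`. -/
def topForm (g : ConvPS n) : formsOfDegree n n :=
  ⟨fun J => if J = Finset.univ then g else 0, fun J hJ => if_neg (by rintro rfl; simp at hJ)⟩

lemma topForm_univ (g : ConvPS n) : (topForm g : Form n) Finset.univ = g := if_pos rfl

lemma apply_eq_zero_of_ne_univ {ω : Form n} (hω : ω ∈ formsOfDegree n n) {J : Finset (Fin n)}
    (hJ : J ≠ Finset.univ) : ω J = 0 :=
  hω J fun hc => hJ (by rw [← Finset.card_eq_iff_eq_univ, hc, Fintype.card_fin])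

lemma form_ext {ω η : Form n} (hω : ω ∈ formsOfDegree n n) (hη : η ∈ formsOfDegree n n)
    (h : ω Finset.univ = η Finset.univ) : ω = η := by
  funext J
  by_cases hJ : J = Finset.univ
  · rw [hJ, h]
  · rw [apply_eq_zero_of_ne_univ hω hJ, apply_eq_zero_of_ne_univ hη hJ]

lemma mem_smul_top_iff_apply_univ (I : Ideal (ConvPS n)) (α : formsOfDegree n n) :
    α ∈ I • (⊤ : Submodule (ConvPS n) (formsOfDegree n n)) ↔ (α : Form n) Finset.univ ∈ I := by
  rw [mem_pow_smul_top]
  refine ⟨fun h => h _, fun h J => ?_⟩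
  by_cases hJ : J = Finset.univ
  · rwa [hJ]
  · rw [apply_eq_zero_of_ne_univ α.2 hJ]
    exact zero_mem _

lemma dfWedge_apply_mem_jacobianIdeal (f : ConvPS n) (η : Form n) (J : Finset (Fin n)) :
    dfWedge f η J ∈ jacobianIdeal f :=
  sum_mem fun i _ => zsmul_mem
    ((jacobianIdeal f).mul_mem_right _ (Ideal.subset_span (Set.mem_range_self i))) _

/-- A top form with coefficient in `⟨∂(f)⟩ I` is `df ∧ η` for a form `η` with coefficients
in `I`. -/
lemma exists_dfWedge_eq_of_mem_mul (hn : 1 ≤ n) {f : ConvPS n} {I : Ideal (ConvPS n)}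
    {ω : Form n} (hω : ω ∈ formsOfDegree n n) (h : ω Finset.univ ∈ I * jacobianIdeal f) :
    ∃ η ∈ formsOfDegree n (n - 1), (∀ J, η J ∈ I) ∧ dfWedge f η = ω := by
  rw [← smul_eq_mul, jacobianIdeal, Ideal.span, Submodule.mem_ideal_smul_span_iff_exists_sum] at h
  obtain ⟨a, ha, e⟩ := h
  rw [Finsupp.sum_fintype _ _ (by simp)] at e
  -- The witness is the volume form contracted with `a`, where `∑ aᵢ ∂ᵢ(f)` is the coefficient of
  -- `ω`. Since `df ∧ dx = 0`, the homotopy formula returns `ω`.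
  have hdeg : contractBy a (topForm 1).1 ∈ formsOfDegree n (n - 1) :=
    fun J hJ => contractBy_eq_zero (topForm 1).2 _ (by omega)
  refine ⟨contractBy a (topForm 1).1, hdeg, contractBy_mem_ideal_of_coeff ha _, ?_⟩
  have hd : n - 1 + 1 = n := by omega
  refine form_ext (by have := dfWedge_mem f hdeg; rwa [hd] at this) hω ?_
  have h0 : dfWedge f (topForm 1).1 = 0 := by
    funext J
    refine dfWedge_mem f (topForm 1).2 J ?_
    have := J.card_le_univ
    simp at this
    omega
  have := dfWedge_contractBy_add f a (topForm 1).1 Finset.univ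
  rw [h0, topForm_univ, mul_one] at this
  rw [← e]
  refine Eq.trans ?_ this
  rw [contractBy_apply]
  simp

/-- By the Leibniz rule, a derivative destroys at most one factor from `⟨x⟩`. -/
lemma partialD_mem_pow (i : Fin n) (k : ℕ) {g : ConvPS n} (hg : g ∈ maxIdeal n ^ k) :
    partialD i g ∈ maxIdeal n ^ (k - 1) := by
  induction k generalizing g with
  | zero => simp
  | succ k ih =>
    rw [pow_succ'] at hg
    refine Submodule.mul_induction_on hg (fun a ha b hb => ?_)
      (fun a b ha hb => by rw [map_add]; exact add_mem ha hb)
    rw [partialD_mul]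
    refine add_mem ?_ (Ideal.mul_mem_left _ _ hb)
    rcases k with _ | k
    · simp
    · change _ ∈ maxIdeal n ^ (k + 1)
      rw [pow_succ']
      exact Ideal.mul_mem_mul ha (ih hb)

/-! ### Comparison of the filtrations -/

lemma sSub_le_xSub (hn : 2 ≤ n) (f : ConvPS n) (k : ℕ) : sSub hn f k ≤ xSub f k := by
  rintro _ ⟨h, rfl⟩
  exact (xFiltration hn f).pow_mem k h

/-- Of the `k + 1 + m` orders, `m` are spent on dividing by `df` and one on applying `d` to the
quotient. -/
lemma exists_sOp_eq_of_mem_xSub (hn : 2 ≤ n) {f : ConvPS n} {m : ℕ}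
    (hm : maxIdeal n ^ m ≤ jacobianIdeal f) (k : ℕ) {h : BrieskornLattice f}
    (hh : h ∈ xSub f (k + 1 + m)) : ∃ g ∈ xSub f k, sOp hn f g = h := by
  obtain ⟨ω, hω, rfl⟩ := hh
  replace hω := (mem_smul_top_iff_apply_univ _ ω).mp hω
  obtain ⟨η, hη, hηI, e⟩ := exists_dfWedge_eq_of_mem_mul (f := f) (I := maxIdeal n ^ (k + 1))
    (by omega) ω.2 (Ideal.mul_mono_right hm (by rwa [← pow_add]))
  have hd : n - 1 + 1 = n := by omega
  have hdη : extD η ∈ formsOfDegree n n := by have := extD_mem hη; rwa [hd] at this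
  refine ⟨formClass f ⟨extD η, hdη⟩, ⟨_, ?_, rfl⟩, sOp_of_primitive hn f hη rfl e.symm⟩
  refine (mem_pow_smul_top _ _).mpr fun J => ?_
  exact sum_mem fun i _ => zsmul_mem (partialD_mem_pow i (k + 1) (hηI _)) _

lemma xSub_anti (hn : 2 ≤ n) (f : ConvPS n) {i j : ℕ} (h : i ≤ j) : xSub f j ≤ xSub f i :=
  (xFiltration hn f).anti h

lemma xSub_le_sSub (hn : 2 ≤ n) {f : ConvPS n} {m : ℕ} (hm1 : 1 ≤ m)
    (hm : maxIdeal n ^ m ≤ jacobianIdeal f) (k : ℕ) : xSub f (2 * k * m) ≤ sSub hn f k := by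
  induction k with
  | zero => rw [sSub, pow_zero, Module.End.one_eq_id, LinearMap.range_id]; exact le_top
  | succ k ih =>
    intro h hh
    -- The factor 2 comes from here: `2km + 1 + m ≤ 2(k+1)m` because `1 ≤ m`.
    obtain ⟨g, hg, rfl⟩ := exists_sOp_eq_of_mem_xSub hn hm (2 * k * m)
      (xSub_anti hn f (by nlinarith) hh)
    obtain ⟨u, rfl⟩ := ih hg
    exact ⟨u, by rw [pow_succ']; rfl⟩

/-! ### The quotient `H'' / sH''` -/

lemma apply_univ_mem_of_mem_relations (f : ConvPS n) {ω : formsOfDegree n n}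
    (h : ω ∈ relations f) : (ω : Form n) Finset.univ ∈ jacobianIdeal f := by
  obtain ⟨ξ, _, e⟩ := (mem_relations f ω).mp h
  rw [← e]
  exact dfWedge_apply_mem_jacobianIdeal f _ _

/-- The map `H'' → ℂ{x} / ⟨∂(f)⟩` that sends `[g dx]` to the class of `g`. -/
def toMilnor (f : ConvPS n) : BrieskornLattice f →ₗ[ℂ] MilnorAlgebra f :=
  (relations f).liftQ ((Ideal.Quotient.mkₐ ℂ (jacobianIdeal f)).toLinearMap ∘ₗ
      LinearMap.proj Finset.univ ∘ₗ (formsOfDegree n n).subtype.restrictScalars ℂ)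
    fun _ h => Ideal.Quotient.eq_zero_iff_mem.mpr (apply_univ_mem_of_mem_relations f h)

lemma toMilnor_formClass (f : ConvPS n) (ω : formsOfDegree n n) :
    toMilnor f (formClass f ω) = Ideal.Quotient.mk _ ((ω : Form n) Finset.univ) := rfl

lemma toMilnor_surjective (f : ConvPS n) : Function.Surjective (toMilnor f) := by
  intro y
  obtain ⟨g, rfl⟩ := Ideal.Quotient.mk_surjective y
  exact ⟨formClass f (topForm g), by rw [toMilnor_formClass, topForm_univ]⟩

/-- Every `(n-1)`-form `η` gives `[df ∧ η] = s[dη]`, so `sH''` is the image of `df ∧ Ωⁿ⁻¹`, the top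
forms with coefficient in `⟨∂(f)⟩`. The relations already lie there. -/
lemma ker_toMilnor (hn : 2 ≤ n) (f : ConvPS n) : LinearMap.ker (toMilnor f) = sSub hn f 1 := by
  ext h
  obtain ⟨ω, rfl⟩ := (relations f).mkQ_surjective h
  rw [LinearMap.mem_ker, toMilnor_formClass, Ideal.Quotient.eq_zero_iff_mem, sSub, pow_one]
  constructor
  · intro hω
    obtain ⟨η, hη, -, e⟩ := exists_dfWedge_eq_of_mem_mul (f := f) (I := ⊤) (by omega) ω.2
      (by rwa [Ideal.top_mul])
    have hd : n - 1 + 1 = n := by omega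
    have hdη : extD η ∈ formsOfDegree n n := by have := extD_mem hη; rwa [hd] at this
    exact ⟨formClass f ⟨extD η, hdη⟩, sOp_of_primitive hn f hη rfl e.symm⟩
  · rintro ⟨g, hg⟩
    obtain ⟨α, rfl⟩ := (relations f).mkQ_surjective g
    rw [sOp_formClass, ← sub_eq_zero, ← map_sub] at hg
    have h1 := apply_univ_mem_of_mem_relations f ((Submodule.Quotient.mk_eq_zero _).mp hg)
    have h2 : (dfWedgePrimitive hn f α : Form n) Finset.univ ∈ jacobianIdeal f :=
      dfWedge_apply_mem_jacobianIdeal f _ _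
    have := sub_mem h2 h1
    rwa [AddSubgroupClass.coe_sub, Pi.sub_apply, sub_sub_cancel] at this

/-- The isomorphism `H'' / sH'' ≃ ℂ{x} / ⟨∂(f)⟩`. -/
def quotientEquivMilnor (hn : 2 ≤ n) (f : ConvPS n) :
    (BrieskornLattice f ⧸ sSub hn f 1) ≃ₗ[ℂ] MilnorAlgebra f :=
  (Submodule.quotEquivOfEq _ _ (ker_toMilnor hn f).symm).trans
    ((toMilnor f).quotKerEquivOfSurjective (toMilnor_surjective f))

namespace SFiltration

variable {H : Type} [AddCommGroup H] [Module ℂ H] {s : Module.End ℂ H} (𝓕 : SFiltration s)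

/-! ### Completions of filtered modules -/

/-- The component of an element of the completion in `H / F k`. -/
def component (k : ℕ) : 𝓕.Completion →+ H ⧸ 𝓕.F k where
  toFun y := y.1 k
  map_zero' := rfl
  map_add' _ _ := rfl

lemma component_apply (k : ℕ) (y : 𝓕.Completion) : 𝓕.component k y = y.1 k := rfl

lemma component_of (k : ℕ) (h : H) : 𝓕.component k (𝓕.of h) = (𝓕.F k).mkQ h := rfl

/-- By compatibility, a representative at level `N` serves all lower levels. Questions about
finitely many components thus become questions in `H`. -/
lemma exists_rep (y : 𝓕.Completion) (N : ℕ) :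
    ∃ h : H, ∀ k ≤ N, 𝓕.component k y = (𝓕.F k).mkQ h := by
  obtain ⟨h, hh⟩ := Submodule.Quotient.mk_surjective _ (y.1 N)
  refine ⟨h, fun k hk => ?_⟩
  rw [component_apply, ← y.2 k N hk, ← hh]
  exact Submodule.factor_mk _ h

lemma aeval_mkQ (k : ℕ) (p : Polynomial ℂ) (h : H) :
    Polynomial.aeval (𝓕.sQuot k) p ((𝓕.F k).mkQ h) = (𝓕.F k).mkQ (Polynomial.aeval s p h) := by
  induction p using Polynomial.induction_on generalizing h with
  | C c => simp [Module.algebraMap_end_apply]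
  | add p q hp hq => simp only [map_add, LinearMap.add_apply, hp, hq]
  | monomial d c ih =>
    rw [pow_succ, ← mul_assoc, map_mul _ _ Polynomial.X, map_mul _ _ Polynomial.X,
      Polynomial.aeval_X, Polynomial.aeval_X, Module.End.mul_apply, Module.End.mul_apply, ← ih]
    rfl

lemma component_smul (a : PowerSeries ℂ) {y : 𝓕.Completion} {k : ℕ} {h : H}
    (e : 𝓕.component k y = (𝓕.F k).mkQ h) :
    𝓕.component k (a • y) = (𝓕.F k).mkQ (Polynomial.aeval s (PowerSeries.trunc k a) h) := by
  rw [← aeval_mkQ, ← e]; rfl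

lemma component_X_smul {y : 𝓕.Completion} {k : ℕ} {h : H}
    (e : 𝓕.component k y = (𝓕.F k).mkQ h) :
    𝓕.component k ((PowerSeries.X : PowerSeries ℂ) • y) = (𝓕.F k).mkQ (s h) := by
  rw [← component_of, ← X_smul_of, component_smul 𝓕 _ e, component_smul 𝓕 _ rfl]

/-- Only the constant term survives truncation at level one. -/
lemma component_one_smul (a : PowerSeries ℂ) (y : 𝓕.Completion) :
    𝓕.component 1 (a • y) = PowerSeries.constantCoeff a • 𝓕.component 1 y := by
  obtain ⟨h, hh⟩ := 𝓕.exists_rep y 1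
  rw [component_smul 𝓕 a (hh 1 le_rfl), hh 1 le_rfl]
  have : PowerSeries.trunc 1 a = Polynomial.C (PowerSeries.constantCoeff a) := by
    ext d
    rw [PowerSeries.coeff_trunc, Polynomial.coeff_C]
    rcases d with _ | d <;> simp
  rw [this, Polynomial.aeval_C, Module.algebraMap_end_apply, map_smul]

lemma component_X_pow_smul (k : ℕ) (y : 𝓕.Completion) :
    𝓕.component k ((PowerSeries.X : PowerSeries ℂ) ^ k • y) = 0 := by
  rw [component_apply, smul_val, 𝓕.aeval_congr (q := Polynomial.X ^ k), map_pow,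
    Polynomial.aeval_X, sQuot_pow, LinearMap.zero_apply]
  intro d hd
  rw [PowerSeries.coeff_trunc, if_pos hd, PowerSeries.coeff_X_pow, Polynomial.coeff_X_pow]

/-- A finer filtration has a completion that maps to the completion of the coarser one. -/
def completionMap {𝓕 𝓖 : SFiltration s} (h : ∀ k, 𝓕.F k ≤ 𝓖.F k) :
    𝓕.Completion →ₗ[PowerSeries ℂ] 𝓖.Completion where
  toFun y := (⟨fun k => Submodule.factor (h k) (y.1 k), fun i j hij => by
    obtain ⟨g, hg⟩ := 𝓕.exists_rep y j
    have hi : y.1 i = _ := hg i hij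
    have hj : y.1 j = _ := hg j le_rfl
    change Submodule.factor _ (Submodule.factor (h j) (y.1 j)) = Submodule.factor (h i) (y.1 i)
    rw [hi, hj]
    rfl⟩ : 𝓖.limit)
  map_add' y z := 𝓖.completion_ext fun k => map_add _ _ _
  map_smul' a y := 𝓖.completion_ext fun k => by
    obtain ⟨g, hg⟩ := 𝓕.exists_rep y k
    change Submodule.factor (h k) (𝓕.component k (a • y)) = Polynomial.aeval (𝓖.sQuot k)
      (PowerSeries.trunc k a) (Submodule.factor (h k) (𝓕.component k y))
    rw [component_smul 𝓕 a (hg k le_rfl), hg k le_rfl]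
    exact (aeval_mkQ 𝓖 k _ g).symm

/-- If each member of either filtration contains a member of the other one, then the completions
are isomorphic. -/
theorem exists_completion_equiv {𝓕 𝓖 : SFiltration s} (h : ∀ k, 𝓕.F k ≤ 𝓖.F k)
    (h' : ∀ k, ∃ j, 𝓖.F j ≤ 𝓕.F k) :
    ∃ e : 𝓕.Completion ≃ₗ[PowerSeries ℂ] 𝓖.Completion, ∀ g, e (𝓕.of g) = 𝓖.of g := by
  choose φ hφ using h'
  refine ⟨LinearEquiv.ofBijective (completionMap h) ⟨?_, ?_⟩, fun g => rfl⟩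
  · refine (injective_iff_map_eq_zero _).mpr fun y hy => 𝓕.completion_ext fun k => ?_
    obtain ⟨g, hg⟩ := 𝓕.exists_rep y (max k (φ k))
    have e1 : y.1 k = _ := hg k (le_max_left _ _)
    have e2 : y.1 (φ k) = _ := hg (φ k) (le_max_right _ _)
    have e3 : Submodule.factor (h (φ k)) (y.1 (φ k)) = 0 :=
      congrArg (fun z : 𝓖.Completion => z.1 (φ k)) hy
    rw [e2] at e3
    rw [e1]
    exact (Submodule.Quotient.mk_eq_zero _).mpr
      (hφ k ((Submodule.Quotient.mk_eq_zero _).mp e3))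
  · intro z
    -- The preimage has as `k`-th component the image of `z (φ k)` in `H / 𝓕.F k`; any
    -- representative of `z` at a level beyond `φ k` computes it.
    have key : ∀ k j g, φ k ≤ j → 𝓖.component j z = (𝓖.F j).mkQ g →
        Submodule.factor (hφ k) (z.1 (φ k)) = (𝓕.F k).mkQ g := by
      intro k j g hkj hg
      have hg' : z.1 j = _ := hg
      rw [← z.2 _ _ hkj, hg']
      rfl
    refine ⟨(⟨fun k => Submodule.factor (hφ k) (z.1 (φ k)), fun i j hij => ?_⟩ : 𝓕.limit), ?_⟩
    -- The choice `φ` need not be monotone, hence the maximum.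
    · obtain ⟨g, hg⟩ := 𝓖.exists_rep z (max (φ i) (φ j))
      change Submodule.factor _ (Submodule.factor (hφ j) (z.1 (φ j)))
        = Submodule.factor (hφ i) (z.1 (φ i))
      rw [key i _ g (le_max_left _ _) (hg _ le_rfl), key j _ g (le_max_right _ _) (hg _ le_rfl)]
      rfl
    · refine 𝓖.completion_ext fun k => ?_
      obtain ⟨g, hg⟩ := 𝓖.exists_rep z (max (φ k) k)
      change Submodule.factor (h k) (Submodule.factor (hφ k) (z.1 (φ k))) = z.1 k
      rw [key k _ g (le_max_left _ _) (hg _ le_rfl)]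
      exact (hg k (le_max_right _ _)).symm

/-! ### Freeness of the `s`-adic completion for injective `s` -/

variable {𝓕}

/-- If `s g ∈ s^(k+1) H`, injectivity gives `g ∈ s^k H`. Cancelling `s` loses one level, so the
representative is taken at level `k + 1`. -/
lemma eq_of_X_smul_eq_zero (hF : ∀ k, 𝓕.F k = LinearMap.range (s ^ k))
    (hs : Function.Injective s) {y : 𝓕.Completion}
    (hy : (PowerSeries.X : PowerSeries ℂ) • y = 0) : y = 0 := by
  refine 𝓕.completion_ext fun k => ?_
  obtain ⟨g, hg⟩ := 𝓕.exists_rep y (k + 1)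
  have h1 := 𝓕.component_X_smul (hg (k + 1) le_rfl)
  rw [hy, map_zero] at h1
  have h2 := (Submodule.Quotient.mk_eq_zero _).mp h1.symm
  rw [hF, pow_succ'] at h2
  obtain ⟨u, hu⟩ := h2
  refine (hg k (Nat.le_succ k)).trans ((Submodule.Quotient.mk_eq_zero _).mpr ?_)
  rw [hF]
  exact ⟨u, hs hu⟩

/-- At each level `k + 1` a representative of `y` lies in `sH`, say `s (g k)`. Injectivity of `s`
makes the classes of the `g k` modulo `s^k H` compatible, and they form `z`. -/
lemma exists_eq_X_smul (hF : ∀ k, 𝓕.F k = LinearMap.range (s ^ k))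
    (hs : Function.Injective s) {y : 𝓕.Completion} (hy : 𝓕.component 1 y = 0) :
    ∃ z : 𝓕.Completion, y = (PowerSeries.X : PowerSeries ℂ) • z := by
  have H : ∀ k, ∃ g, 𝓕.component (k + 1) y = (𝓕.F (k + 1)).mkQ (s g) := by
    intro k
    obtain ⟨h, hh⟩ := 𝓕.exists_rep y (k + 1)
    have h1 := hh 1 (by omega)
    rw [hy] at h1
    have h2 := (Submodule.Quotient.mk_eq_zero _).mp h1.symm
    rw [hF, pow_one] at h2
    obtain ⟨g, rfl⟩ := h2
    exact ⟨g, hh _ le_rfl⟩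
  choose g hg using H
  refine ⟨(⟨fun k => (𝓕.F k).mkQ (g k), fun i j hij => ?_⟩ : 𝓕.limit), ?_⟩
  · have h1 := y.2 (i + 1) (j + 1) (by omega)
    rw [← component_apply, ← component_apply, hg, hg] at h1
    have h2 : s (g j) - s (g i) ∈ 𝓕.F (i + 1) := (Submodule.Quotient.eq _).mp h1
    rw [hF, pow_succ', ← map_sub] at h2
    obtain ⟨u, hu⟩ := h2
    refine (Submodule.Quotient.eq _).mpr ?_
    rw [hF]
    exact ⟨u, hs hu⟩
  · refine 𝓕.completion_ext fun k => ?_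
    refine Eq.trans ?_ (𝓕.component_X_smul (h := g k) rfl).symm
    have h1 := hg k
    rw [component_apply] at h1
    rw [← y.2 k (k + 1) (Nat.le_succ k), h1]
    rfl

/-- If `s` is injective, then the `s`-adic completion of `H` is free over `ℂ⟦s⟧`, and lifts of a
basis of `H / sH` form a basis. -/
theorem nonempty_completion_equiv_pi (hF : ∀ k, 𝓕.F k = LinearMap.range (s ^ k))
    (hs : Function.Injective s) {ι : Type} [Fintype ι] (b : Module.Basis ι ℂ (H ⧸ 𝓕.F 1)) :
    Nonempty ((ι → PowerSeries ℂ) ≃ₗ[PowerSeries ℂ] 𝓕.Completion) := by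
  choose h hh using fun i => (𝓕.F 1).mkQ_surjective (b i)
  set Φ := Fintype.linearCombination (PowerSeries ℂ) (fun i => 𝓕.of (h i)) with hΦ
  have hΦ1 : ∀ a, 𝓕.component 1 (Φ a) = ∑ i, PowerSeries.constantCoeff (a i) • b i := by
    intro a
    rw [hΦ, Fintype.linearCombination_apply, map_sum]
    refine Finset.sum_congr rfl fun i _ => ?_
    rw [component_one_smul, component_of, hh]
  refine ⟨LinearEquiv.ofBijective Φ ⟨?_, ?_⟩⟩
  · refine (injective_iff_map_eq_zero _).mpr fun a ha => ?_
    -- The relation `a` varies in the induction: independence modulo `sH` gives `a = X c`,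
    -- torsion-freeness gives `Φ c = 0`, and the coefficients of `c` are those of `a` shifted by
    -- one.
    have key : ∀ k, ∀ a, Φ a = 0 → ∀ i, PowerSeries.coeff k (a i) = 0 := by
      intro k
      induction k with
      | zero =>
        intro a ha i
        have := hΦ1 a
        rw [ha, map_zero] at this
        simpa using Fintype.linearIndependent_iff.mp b.linearIndependent _ this.symm i
      | succ k ih =>
        intro a ha i
        have h0 := hΦ1 a
        rw [ha, map_zero] at h0
        have h1 : ∀ i, ∃ c, a i = PowerSeries.X * c := fun i => PowerSeries.X_dvd_iff.mpr
          (Fintype.linearIndependent_iff.mp b.linearIndependent _ h0.symm i)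
        choose c hc using h1
        have hac : a = (PowerSeries.X : PowerSeries ℂ) • c := funext hc
        rw [hac, map_smul] at ha
        rw [hc, PowerSeries.coeff_succ_X_mul]
        exact ih c (eq_of_X_smul_eq_zero hF hs ha) i
    exact funext fun i => PowerSeries.ext fun k => key k a ha i
  · have step : ∀ y, ∃ c : ι → ℂ, ∃ z,
        y = Φ (fun i => PowerSeries.C (c i)) + (PowerSeries.X : PowerSeries ℂ) • z := by
      intro y
      refine ⟨b.repr (𝓕.component 1 y), ?_⟩
      obtain ⟨z, hz⟩ := exists_eq_X_smul hF hs
        (y := y - Φ fun i => PowerSeries.C (b.repr (𝓕.component 1 y) i)) (by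
          rw [map_sub, hΦ1]
          simp only [PowerSeries.constantCoeff_C, b.sum_repr, sub_self])
      exact ⟨z, by rw [← hz, add_sub_cancel]⟩
    choose c t hct using step
    -- Iterating `y = Φ(c y) + X (t y)` gives formally `y = ∑ X^k Φ(c (t^k y))`; `A` collects these
    -- constants as power series.
    set A : 𝓕.Completion → ι → PowerSeries ℂ :=
      fun y i => PowerSeries.mk fun k => c (t^[k] y) i with hA
    have hAs : ∀ y, A y = (fun i => PowerSeries.C (c y i))
        + (PowerSeries.X : PowerSeries ℂ) • A (t y) := by
      intro y
      funext i
      ext k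
      rw [Pi.add_apply, Pi.smul_apply, smul_eq_mul, map_add]
      rcases k with _ | k
      · simp [hA]
      · rw [PowerSeries.coeff_succ_X_mul]
        simp [hA]
    -- The error of `y` is `X` times the error of `t y`, hence divisible by every power of `X`, so
    -- all its components vanish.
    have approx : ∀ k y, ∃ z, y - Φ (A y) = (PowerSeries.X : PowerSeries ℂ) ^ k • z := by
      intro k
      induction k with
      | zero => exact fun y => ⟨_, by rw [pow_zero, one_smul]⟩
      | succ k ih =>
        intro y
        obtain ⟨z, hz⟩ := ih (t y)
        refine ⟨z, ?_⟩
        rw [pow_succ', mul_smul, ← hz, smul_sub, ← map_smul]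
        nth_rewrite 1 [hct y]
        rw [hAs y, map_add]
        abel
    refine fun y => ⟨A y, (sub_eq_zero.mp ?_).symm⟩
    refine 𝓕.completion_ext fun k => ?_
    obtain ⟨z, hz⟩ := approx k y
    rw [hz]
    exact 𝓕.component_X_pow_smul k z

end SFiltration

open scoped Topology

/-! ### Topologies -/

lemma isOpen_adicModuleTopology_iff {R : Type*} [CommRing R] (I : Ideal R) {M : Type*}
    [AddCommGroup M] [Module R M] (U : Set M) :
    IsOpen[I.adicModuleTopology M] U ↔
      ∀ u ∈ U, ∃ k : ℕ, ∀ h ∈ (I ^ k • ⊤ : Submodule R M), u + h ∈ U := by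
  let := I.adicTopology
  let B := (I.ringFilterBasis.moduleFilterBasis (I.adic_module_basis M)).toAddGroupFilterBasis
  have hB : I.adicModuleTopology M = B.topology := rfl
  rw [hB]
  let := B.topology
  rw [isOpen_iff_mem_nhds]
  refine forall₂_congr fun u _ => ?_
  rw [(B.nhds_hasBasis u).mem_iff]
  constructor
  · rintro ⟨V, ⟨k, rfl⟩, hV⟩
    exact ⟨k, fun h hh => hV ⟨h, hh, rfl⟩⟩
  · rintro ⟨k, hk⟩
    refine ⟨_, ⟨k, rfl⟩, ?_⟩
    rintro _ ⟨h, hh, rfl⟩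
    exact hk h hh

lemma isOpen_xAdicTopology_iff (f : ConvPS n) (U : Set (BrieskornLattice f)) :
    IsOpen[xAdicTopology f] U ↔ ∀ u ∈ U, ∃ k : ℕ, ∀ h ∈ xSub f k, u + h ∈ U := by
  rw [isOpen_coinduced, isOpen_adicModuleTopology_iff]
  constructor
  · intro H u hu
    obtain ⟨ω, rfl⟩ := (relations f).mkQ_surjective u
    obtain ⟨k, hk⟩ := H ω hu
    refine ⟨k, ?_⟩
    rintro _ ⟨α, hα, rfl⟩
    exact hk α hα
  · intro H ω hω
    obtain ⟨k, hk⟩ := H _ hω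
    exact ⟨k, fun α hα => hk _ ⟨α, hα, rfl⟩⟩

/-- The ideal power is principal, generated by `X^k`, which acts as `s^k`. -/
lemma of_mem_span_X_pow_smul_top_iff {H : Type*} [AddCommGroup H] [Module ℂ H]
    (s : Module.End ℂ H) (k : ℕ) (h : H) :
    Module.AEval'.of s h ∈ (Ideal.span {(Polynomial.X : Polynomial ℂ)} ^ k • ⊤ :
      Submodule (Polynomial ℂ) (Module.AEval' s)) ↔ h ∈ LinearMap.range (s ^ k) := by
  rw [Ideal.span_singleton_pow, Submodule.ideal_span_singleton_smul,
    Submodule.mem_smul_pointwise_iff_exists]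
  constructor
  · rintro ⟨y, -, hy⟩
    obtain ⟨g, rfl⟩ := (Module.AEval'.of s).surjective y
    rw [Module.AEval'.X_pow_smul_of] at hy
    exact ⟨g, (Module.AEval'.of s).injective hy⟩
  · rintro ⟨g, rfl⟩
    exact ⟨Module.AEval'.of s g, trivial, Module.AEval'.X_pow_smul_of ..⟩

lemma isOpen_sAdicTopology_iff (hn : 2 ≤ n) (f : ConvPS n) (U : Set (BrieskornLattice f)) :
    IsOpen[sAdicTopology hn f] U ↔ ∀ u ∈ U, ∃ k : ℕ, ∀ h ∈ sSub hn f k, u + h ∈ U := by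
  -- `Module.AEval'.of` is a bijection, so the induced topology is a transport and openness can be
  -- tested on the `ℂ[X]`-module.
  have key : IsOpen[sAdicTopology hn f] U ↔
      IsOpen[(Ideal.span {(Polynomial.X : Polynomial ℂ)}).adicModuleTopology
        (Module.AEval' (sOp hn f))] ((Module.AEval'.of (sOp hn f)).symm ⁻¹' U) := by
    rw [@isOpen_induced_iff _ _ (_)]
    constructor
    · rintro ⟨t, ht, rfl⟩
      convert ht
      ext y
      simp
    · exact fun h => ⟨_, h, by ext y; simp⟩
  rw [key, isOpen_adicModuleTopology_iff]
  constructor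
  · intro H u hu
    obtain ⟨k, hk⟩ := H (Module.AEval'.of (sOp hn f) u) (by simpa using hu)
    refine ⟨k, fun h hh => ?_⟩
    simpa using hk _ ((of_mem_span_X_pow_smul_top_iff _ k h).mpr hh)
  · intro H y hy
    obtain ⟨k, hk⟩ := H _ hy
    refine ⟨k, fun z hz => ?_⟩
    obtain ⟨h, rfl⟩ := (Module.AEval'.of (sOp hn f)).surjective z
    rw [Set.mem_preimage, map_add, LinearEquiv.symm_apply_apply]
    exact hk h ((of_mem_span_X_pow_smul_top_iff _ k h).mp hz)

theorem sAdicTopology_eq_xAdicTopology (hn : 2 ≤ n) {f : ConvPS n} {m : ℕ} (hm1 : 1 ≤ m)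
    (hm : maxIdeal n ^ m ≤ jacobianIdeal f) : sAdicTopology hn f = xAdicTopology f := by
  refine TopologicalSpace.ext_iff.mpr fun U => ?_
  rw [isOpen_sAdicTopology_iff, isOpen_xAdicTopology_iff]
  refine forall₂_congr fun u _ => ?_
  constructor
  · rintro ⟨k, hk⟩
    exact ⟨2 * k * m, fun h hh => hk h (xSub_le_sSub hn hm1 hm k hh)⟩
  · rintro ⟨k, hk⟩
    exact ⟨k, fun h hh => hk h (sSub_le_xSub hn f k hh)⟩

/-! ### The formal Brieskorn lattice -/

theorem nonempty_pi_equiv_sAdicCompletion (hn : 2 ≤ n) {f : ConvPS n} {m : ℕ}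
    (hm : maxIdeal n ^ m ≤ jacobianIdeal f) :
    Nonempty ((Fin (milnorNumber f) → PowerSeries ℂ) ≃ₗ[PowerSeries ℂ] SAdicCompletion hn f) := by
  have := finite_milnorAlgebra hm
  exact SFiltration.nonempty_completion_equiv_pi (fun _ => rfl)
    (sOp_injective hn fun i =>
      hm (Ideal.pow_mem_pow (Ideal.subset_span (Set.mem_range_self i)) m))
    -- A basis of the Milnor algebra, carried to `H''/sH''`, indexes the free generators; this is
    -- why the rank is `μ`.
    ((Module.finBasis ℂ (MilnorAlgebra f)).map (quotientEquivMilnor hn f).symm)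

end Brieskorn

end

theorem mainTheorem8 (n : ℕ) (hn : 2 ≤ n) (f : Brieskorn.ConvPS n)
    (hf0 : MvPowerSeries.constantCoeff f.1 = 0) (hf : Brieskorn.IsIsolatedCriticalPoint f) :
    -- `s^k H''` lies between the images of `⟨x⟩^(2km)` and `⟨x⟩^k`
    (∀ m : ℕ, 1 ≤ m → Brieskorn.maxIdeal n ^ m ≤ Brieskorn.jacobianIdeal f →
      ∀ k : ℕ, Brieskorn.xSub f (2 * k * m) ≤ Brieskorn.sSub hn f k ∧
        Brieskorn.sSub hn f k ≤ Brieskorn.xSub f k) ∧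
    -- the two topologies coincide
    Brieskorn.sAdicTopology hn f = Brieskorn.xAdicTopology f ∧
    -- the `⟨s⟩`-adic completion is naturally isomorphic to the formal Brieskorn lattice
    (∃ e : Brieskorn.SAdicCompletion hn f ≃ₗ[PowerSeries ℂ] Brieskorn.FormalBrieskornLattice hn f,
      ∀ h : Brieskorn.BrieskornLattice f,
        e ((Brieskorn.sFiltration hn f).of h) = (Brieskorn.xFiltration hn f).of h) ∧
    -- the formal Brieskorn lattice is free of rank `μ < ∞` over `ℂ⟦s⟧`
    Module.Finite ℂ (Brieskorn.MilnorAlgebra f) ∧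
    Module.Free (PowerSeries ℂ) (Brieskorn.FormalBrieskornLattice hn f) ∧
    Module.Finite (PowerSeries ℂ) (Brieskorn.FormalBrieskornLattice hn f) ∧
    Module.finrank (PowerSeries ℂ) (Brieskorn.FormalBrieskornLattice hn f)
      = Brieskorn.milnorNumber f := by
  obtain ⟨m, hm1, hm⟩ := hf.2
  obtain ⟨e, he⟩ := Brieskorn.SFiltration.exists_completion_equiv
    (𝓕 := Brieskorn.sFiltration hn f) (𝓖 := Brieskorn.xFiltration hn f)
    (Brieskorn.sSub_le_xSub hn f) fun k => ⟨_, Brieskorn.xSub_le_sSub hn hm1 hm k⟩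
  -- Coordinates exist on the `s`-adic completion; composing with `e` carries freeness and rank to
  -- the formal Brieskorn lattice.
  obtain ⟨b⟩ := Brieskorn.nonempty_pi_equiv_sAdicCompletion hn hm
  refine ⟨fun m hm1 hm k => ⟨Brieskorn.xSub_le_sSub hn hm1 hm k, Brieskorn.sSub_le_xSub hn f k⟩,
    Brieskorn.sAdicTopology_eq_xAdicTopology hn hm1 hm, ⟨e, he⟩,
    Brieskorn.finite_milnorAlgebra hm, Module.Free.of_equiv (b.trans e),
    Module.Finite.equiv (b.trans e), ?_⟩
  rw [← (b.trans e).finrank_eq, Module.finrank_pi, Fintype.card_fin]
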